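/- Let $s,t>1$ be coprime integers. Identify a partition with its Young diagram; write $|\lambda|$ for its size and $\lambda'$ for its conjugate. A rim $k$-hook of $\lambda$ ($k\ge 1$) is a connected set of $k$ nodes of the rim of $\lambda$ (the nodes $(r,c)$ of $\lambda$ such that $(r+1,c+1)$ is not a node of $\lambda$) whose removal leaves the Young diagram of a partition; $\lambda$ is an $s$-core if it has no rim $s$-hook. Let $\operatorname{cor}_s(\lambda)$ be the $s$-core of $\lambda$, obtained by repeatedly removing rim $s$-hooks from $\lambda$ until none remain, and let $\operatorname{wei}_s(\lambda)$ be the number of rim $s$-hooks removed in this process. For an $s$-core $\sigma$, a $t$-core $\tau$ and $n\ge 0$, let $\mathcal P_{\sigma,\tau}(n)$ be the set of partitions $\lambda$ of $n$ with $\operatorname{cor}_s(\lambda)=\sigma$ and $\operatorname{cor}_t(\lambda)=\tau$, and let $\mathtt m_{\sigma,\tau}$ be the smallest $m$ for which $\mathcal P_{\sigma,\tau}(m)\neq\emptyset$. **Theorem.** Let $\sigma$ be an $s$-core, $\tau$ a $t$-core and $n\ge 0$ an integer. The following are equivalent. 1. $\mathcal P_{\sigma,\tau}(n)$ has exactly two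 elements, and they form a conjugate pair; that is, $\mathcal P_{\sigma,\tau}(n)=\{\lambda,\lambda'\}$ for some partition $\lambda\ne\lambda'$. 2. $\sigma'=\sigma$, $\tau'=\tau$, the partition $\operatorname{cor}_t(\sigma)$ is obtained from $\operatorname{cor}_s(\tau)$ by adding or removing a rim hook (of some length), and $$n=|\sigma|+s\bigl(\operatorname{wei}_s(\tau)+1\bigr)=|\tau|+t\bigl(\operatorname{wei}_t(\sigma)+1\bigr).$$ 3. $\sigma'=\sigma$, $\tau'=\tau$, and $$n=\mathtt m_{\sigma,\tau}=|\sigma|+s\bigl(\operatorname{wei}_s(\tau)+1\bigr)=|\tau|+t\bigl(\operatorname{wei}_t(\sigma)+1\bigr).$$ -/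

import Mathlib

/- Partitions are Mathlib's `YoungDiagram`s (English convention, rows and columns numbered
from `0`); `YoungDiagram.card` is the size of the partition and `YoungDiagram.transpose` is the
conjugate partition. -/

/-- `IsRimHookRemoval s lam mu`: the partition `mu` is obtained from `lam` by removing a rim
`s`-hook, i.e. the removed nodes form a connected (in particular non-empty) set of `s` nodes of
the rim of `lam`, where the rim consists of the nodes `(r, c)` of `lam` such that `(r+1, c+1)` is
not a node. Connectedness is with respect to adjacency of nodes in the grid: two nodes are adjacent
when one covers the other in the product order on `ℕ × ℕ`, i.e. when they share an edge. -/
structure IsRimHookRemoval (s : ℕ) (lam mu : YoungDiagram) : Prop where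
  le : mu ≤ lam
  card_eq : (lam.cells \ mu.cells).card = s
  connected : ((SimpleGraph.hasse (ℕ × ℕ)).induce
    ((lam.cells \ mu.cells : Finset (ℕ × ℕ)) : Set (ℕ × ℕ))).Connected
  rim : ∀ x ∈ lam.cells \ mu.cells, (x.1 + 1, x.2 + 1) ∉ lam.cells

theorem IsRimHookRemoval.card_lt {s : ℕ} {lam mu : YoungDiagram}
    (h : IsRimHookRemoval s lam mu) : mu.card < lam.card := by
  obtain ⟨x, hx⟩ := h.connected.nonempty
  have hx' : x ∈ lam.cells \ mu.cells := hx
  rw [Finset.mem_sdiff] at hx'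
  exact Finset.card_lt_card
    ⟨YoungDiagram.cells_subset_iff.mpr h.le, fun hle => hx'.2 (hle hx'.1)⟩

/-- A partition is an `s`-core if it has no rim `s`-hooks. -/
def IsCorePartition (s : ℕ) (lam : YoungDiagram) : Prop :=
  ∀ mu : YoungDiagram, ¬ IsRimHookRemoval s lam mu

open Classical in
/-- The `s`-core of `lam`: remove (arbitrarily chosen) rim `s`-hooks until none remain. -/
noncomputable def corePart (s : ℕ) (lam : YoungDiagram) : YoungDiagram :=
  if h : ∃ mu, IsRimHookRemoval s lam mu then corePart s h.choose else lam
termination_by lam.card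
decreasing_by exact h.choose_spec.card_lt

open Classical in
/-- The `s`-weight of `lam`: the number of rim `s`-hooks removed to reach the `s`-core. -/
noncomputable def coreWeight (s : ℕ) (lam : YoungDiagram) : ℕ :=
  if h : ∃ mu, IsRimHookRemoval s lam mu then coreWeight s h.choose + 1 else 0
termination_by lam.card
decreasing_by exact h.choose_spec.card_lt

/-- The set of partitions of `n` with `s`-core `sig` and `t`-core `tau`. -/
def partitionsWithCores (s t : ℕ) (sig tau : YoungDiagram) (n : ℕ) : Set YoungDiagram :=
  {lam | lam.card = n ∧ corePart s lam = sig ∧ corePart t lam = tau}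

/-- The smallest size of a partition with `s`-core `sig` and `t`-core `tau` (such partitions exist
whenever `s`, `t` are coprime positive integers, `sig` is an `s`-core and `tau` is a `t`-core). -/
noncomputable def minSizeWithCores (s t : ℕ) (sig tau : YoungDiagram) : ℕ :=
  sInf {m : ℕ | (partitionsWithCores s t sig tau m).Nonempty}

/-! ### Finitely supported charge functions on `ℤ` -/

/-! Encode a partition by beads on the integers, each node of content `c` pushing a bead from `c -
1` to `c`. Removing a rim hook of length `k` moves one bead down by `k`
(`IsRimHookRemoval.exists_maya_eq`, `isRimHookRemoval_of_moveBead`), so the `s`-core is determined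
by the charges on the residue classes modulo `s` (`corePart_eq_iff`). As `s` and `t` are coprime,
every integer is uniquely `origin + i * t + j * s + s * t * l` with `0 ≤ i < s` and `0 ≤ j < t`,
where `i` records the class modulo `s` and `j` the class modulo `t`. If each class modulo `s * t` is
filled up to level `b i j`, prescribing the two cores means prescribing the row and column sums of
the matrix `b`.

These margins are attained by a matrix `M i j + u i + v j` with `M` zero-one
(`exists_zero_one_add_potential`). A position is a function of its row, plus a function of its
column, plus `s * t` times its level relative to `u i + v j`; hence, for given cores, the size is a
constant plus `s * t` times the total relative level. Filling all negative levels and no positive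
one minimises this, so the partitions of least size correspond to the zero-one matrices with the
margins of `M`. Any larger size that occurs has at least `s * t` partitions, too many for a
conjugate pair.

What remains concerns zero-one matrices. The quantity `marginGap` depends only on the margins. There
are exactly two matrices precisely when `M` has a single interchange, that is, when the gaps of `M`
and of its transpose are both 2. By `CoreWindow.size_eq` these are the two numerical equations at
the least size. In the window, the cores of the cores are the Young diagrams of the row sums and of
the conjugate of the column sums. A single interchange makes them differ by moving one cell, hence
one bead, hence a rim hook; conversely a rim hook bounds the gap by `2 * (t - 1)`, and coprimality
with the numerical equations forces it to be 2. Finally, reflecting the beads shows that the two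
partitions cannot both be self-conjugate. -/

/-- The pairing of a finitely supported function on `ℤ` with a weight function. -/
noncomputable abbrev pairing (w : ℤ → ℤ) : (ℤ →₀ ℤ) →ₗ[ℤ] ℤ := Finsupp.linearCombination ℤ w

theorem pairing_single (w : ℤ → ℤ) (x a : ℤ) : pairing w (Finsupp.single x a) = a * w x := by
  simp [pairing, Finsupp.linearCombination_single]

theorem pairing_eq_sum (w : ℤ → ℤ) (f : ℤ →₀ ℤ) :
    pairing w f = ∑ x ∈ f.support, f x * w x := by
  simp [pairing, Finsupp.linearCombination_apply, Finsupp.sum]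

theorem pairing_add_weight (w v : ℤ → ℤ) (f : ℤ →₀ ℤ) :
    pairing (fun x => w x + v x) f = pairing w f + pairing v f := by
  simp only [pairing_eq_sum, mul_add, Finset.sum_add_distrib]

theorem pairing_sub_weight (w v : ℤ → ℤ) (f : ℤ →₀ ℤ) :
    pairing (fun x => w x - v x) f = pairing w f - pairing v f := by
  simp only [pairing_eq_sum, mul_sub, Finset.sum_sub_distrib]

theorem pairing_mul_weight (a : ℤ) (w : ℤ → ℤ) (f : ℤ →₀ ℤ) :
    pairing (fun x => a * w x) f = a * pairing w f := by
  simp only [pairing_eq_sum, Finset.mul_sum]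
  exact Finset.sum_congr rfl fun x _ => by ring

theorem pairing_sum_weight {ι : Type*} (S : Finset ι) (w : ι → ℤ → ℤ) (f : ℤ →₀ ℤ) :
    pairing (fun x => ∑ i ∈ S, w i x) f = ∑ i ∈ S, pairing (w i) f := by
  simp only [pairing_eq_sum, Finset.mul_sum]
  exact Finset.sum_comm

theorem pairing_indicator_eq (c : ℤ) (f : ℤ →₀ ℤ) :
    pairing (fun x => if x = c then 1 else 0) f = f c := by
  rw [pairing_eq_sum]
  simp only [mul_ite, mul_one, mul_zero, Finset.sum_ite_eq', Finsupp.mem_support_iff]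
  split_ifs with h
  · rfl
  · exact (not_not.mp h).symm

theorem pairing_nonneg {w : ℤ → ℤ} {f : ℤ →₀ ℤ} (h : ∀ x, 0 ≤ f x * w x) : 0 ≤ pairing w f := by
  rw [pairing_eq_sum]
  exact Finset.sum_nonneg fun x _ => h x

theorem mul_eq_zero_of_pairing_eq_zero {w : ℤ → ℤ} {f : ℤ →₀ ℤ} (h : ∀ x, 0 ≤ f x * w x)
    (h0 : pairing w f = 0) (x : ℤ) : f x * w x = 0 := by
  rw [pairing_eq_sum, Finset.sum_eq_zero_iff_of_nonneg fun x _ => h x] at h0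
  by_cases hx : x ∈ f.support
  · exact h0 x hx
  · rw [Finsupp.notMem_support_iff.mp hx, zero_mul]

/-- The sum of the values of `f` at the integers at least `c`. -/
noncomputable def tailSum (f : ℤ →₀ ℤ) (c : ℤ) : ℤ := pairing (fun x => if c ≤ x then 1 else 0) f

theorem tailSum_sub (f : ℤ →₀ ℤ) (c : ℤ) : tailSum f c - tailSum f (c + 1) = f c := by
  rw [tailSum, tailSum, ← pairing_sub_weight, ← pairing_indicator_eq]
  congr 2
  funext x
  split_ifs <;> omega

/-- The occupancy (1 for a bead, 0 for a gap) of position `x` in the bead configuration whose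
difference to the ground state (beads at all negative positions) is `f`. -/
noncomputable def occ (f : ℤ →₀ ℤ) (x : ℤ) : ℤ := f x + if x < 0 then 1 else 0

/-- `f` is the difference between a bead configuration and the ground state. -/
def IsMaya (f : ℤ →₀ ℤ) : Prop := ∀ x, occ f x = 0 ∨ occ f x = 1

theorem IsMaya.of_nonneg {f : ℤ →₀ ℤ} (h : IsMaya f) {x : ℤ} (hx : 0 ≤ x) : f x = 0 ∨ f x = 1 := by
  simpa [occ, not_lt.mpr hx] using h x

theorem IsMaya.of_neg {f : ℤ →₀ ℤ} (h : IsMaya f) {x : ℤ} (hx : x < 0) : f x = 0 ∨ f x = -1 := by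
  have := h x
  simp only [occ, hx, if_true] at this
  omega

theorem occ_sub_occ (f g : ℤ →₀ ℤ) (x : ℤ) : occ f x - occ g x = f x - g x := by
  simp [occ]

theorem ext_of_occ {f g : ℤ →₀ ℤ} (h : ∀ x, occ f x = occ g x) : f = g :=
  Finsupp.ext fun x => by simpa [occ] using h x

/-- Moving a bead from `x` to `y`. -/
noncomputable def moveBead (f : ℤ →₀ ℤ) (x y : ℤ) : ℤ →₀ ℤ :=
  f - Finsupp.single x 1 + Finsupp.single y 1

theorem moveBead_apply (f : ℤ →₀ ℤ) (x y z : ℤ) :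
    moveBead f x y z = f z - (if z = x then 1 else 0) + (if z = y then 1 else 0) := by
  simp [moveBead, Finsupp.single_apply, eq_comm]

theorem pairing_moveBead (w : ℤ → ℤ) (f : ℤ →₀ ℤ) (x y : ℤ) :
    pairing w (moveBead f x y) = pairing w f - w x + w y := by
  simp [moveBead, map_add, map_sub]

theorem IsMaya.moveBead {f : ℤ →₀ ℤ} (h : IsMaya f) {x y : ℤ} (hx : occ f x = 1)
    (hy : occ f y = 0) : IsMaya (moveBead f x y) := by
  intro z
  have hz := h z
  have hxy : x ≠ y := by rintro rfl; omega
  simp only [occ, moveBead_apply] at *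
  by_cases h1 : z = x
  · subst h1
    simp only [if_true, hxy, if_false]
    omega
  · by_cases h2 : z = y
    · subst h2
      simp only [if_true, h1, if_false]
      omega
    · simpa only [h1, h2, if_false, sub_zero, add_zero] using hz

/-- The values of `f` are nonnegative at nonnegative positions. For a negative cut, total charge
zero turns the tail into minus the sum over smaller positions, where the values are nonpositive. -/
theorem IsMaya.tailSum_nonneg {f : ℤ →₀ ℤ} (h : IsMaya f) (h0 : pairing (fun _ => 1) f = 0) (c : ℤ) :
    0 ≤ tailSum f c := by
  rcases le_or_gt 0 c with hc | hc
  · refine pairing_nonneg fun x => ?_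
    split_ifs with hx
    · have := h.of_nonneg (hc.trans hx)
      omega
    · simp
  · have : tailSum f c = pairing (fun x => - (if x < c then 1 else 0)) f := by
      rw [← sub_zero (tailSum f c), ← h0, tailSum, ← pairing_sub_weight]
      congr 2
      funext x
      split_ifs <;> omega
    rw [this]
    refine pairing_nonneg fun x => ?_
    split_ifs with hx
    · have := h.of_neg (hx.trans hc)
      omega
    · simp

/-! ### Diagonals of Young diagrams -/

/-- The content (column minus row) of a node. -/
def nodeContent (x : ℕ × ℕ) : ℤ := (x.2 : ℤ) - x.1

/-- The `m`-th node on the diagonal of content `c`. -/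
def diagNode (c : ℤ) (m : ℕ) : ℕ × ℕ := (m + (-c).toNat, m + c.toNat)

theorem diagNode_nodeContent (x : ℕ × ℕ) : diagNode (nodeContent x) (min x.1 x.2) = x := by
  simp only [diagNode, nodeContent]
  ext <;> simp only <;> omega

theorem nodeContent_diagNode (c : ℤ) (m : ℕ) : nodeContent (diagNode c m) = c := by
  simp only [diagNode, nodeContent]
  omega

theorem diagNode_injective (c : ℤ) : Function.Injective (diagNode c) := by
  intro m n h
  simp only [diagNode, Prod.mk.injEq] at h
  omega

namespace YoungDiagram

/-- The number of nodes of `lam` of content `c`. -/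
def diagLen (lam : YoungDiagram) (c : ℤ) : ℕ := (lam.cells.filter fun x => nodeContent x = c).card

theorem diagNode_mem_iff (lam : YoungDiagram) (c : ℤ) (m : ℕ) :
    diagNode c m ∈ lam ↔ m < lam.diagLen c := by
  classical
  have hex : ∃ m, diagNode c m ∉ lam := by
    by_contra! hall
    exact Set.infinite_of_injective_forall_mem (diagNode_injective c) hall
      (lam.cells.finite_toSet)
  have hiff : ∀ m, diagNode c m ∈ lam ↔ m < Nat.find hex := by
    intro m
    constructor
    · intro hm
      by_contra! hle
      exact Nat.find_spec hex (lam.up_left_mem (by omega) (by omega) hm)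
    · intro hm
      exact not_not.mp (Nat.find_min hex hm)
  have hset : (lam.cells.filter fun x => nodeContent x = c) =
      (Finset.range (Nat.find hex)).image (diagNode c) := by
    ext x
    simp only [Finset.mem_filter, Finset.mem_image, Finset.mem_range, mem_cells]
    constructor
    · rintro ⟨hx, rfl⟩
      exact ⟨_, (hiff _).mp (by rwa [diagNode_nodeContent]), diagNode_nodeContent x⟩
    · rintro ⟨m, hm, rfl⟩
      exact ⟨(hiff m).mpr hm, nodeContent_diagNode c m⟩
  rw [hiff, diagLen, hset, Finset.card_image_of_injective _ (diagNode_injective c),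
    Finset.card_range]

theorem mem_iff_lt_diagLen (lam : YoungDiagram) (x : ℕ × ℕ) :
    x ∈ lam ↔ min x.1 x.2 < lam.diagLen (nodeContent x) := by
  rw [← diagNode_mem_iff, diagNode_nodeContent]

/-- The charge function of a partition: its bead configuration minus the ground state. -/
noncomputable def maya (lam : YoungDiagram) : ℤ →₀ ℤ :=
  ∑ x ∈ lam.cells, (Finsupp.single (nodeContent x) 1 - Finsupp.single (nodeContent x - 1) 1)

theorem pairing_maya (w : ℤ → ℤ) (lam : YoungDiagram) :
    pairing w lam.maya = ∑ x ∈ lam.cells, (w (nodeContent x) - w (nodeContent x - 1)) := by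
  simp [maya, map_sum, map_sub]

theorem pairing_id_maya (lam : YoungDiagram) : pairing (fun x => x) lam.maya = lam.card := by
  simp [pairing_maya]

theorem pairing_one_maya (lam : YoungDiagram) : pairing (fun _ => 1) lam.maya = 0 := by
  simp [pairing_maya]

theorem tailSum_maya (lam : YoungDiagram) (c : ℤ) : tailSum lam.maya c = lam.diagLen c := by
  rw [tailSum, pairing_maya, diagLen, Finset.card_filter]
  push_cast
  refine Finset.sum_congr rfl fun x _ => ?_
  split_ifs <;> omega

theorem maya_apply (lam : YoungDiagram) (c : ℤ) :
    lam.maya c = lam.diagLen c - lam.diagLen (c + 1) := by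
  rw [← tailSum_sub, tailSum_maya, tailSum_maya]

theorem ext_of_diagLen {lam mu : YoungDiagram} (h : ∀ c, lam.diagLen c = mu.diagLen c) :
    lam = mu := by
  refine SetLike.ext fun x => ?_
  rw [mem_iff_lt_diagLen, mem_iff_lt_diagLen, h]

theorem maya_injective : Function.Injective maya := by
  intro lam mu h
  refine ext_of_diagLen fun c => ?_
  have : (lam.diagLen c : ℤ) = mu.diagLen c := by rw [← tailSum_maya, ← tailSum_maya, h]
  exact_mod_cast this

/-- Stepping up or left from a node leads to a neighbouring diagonal, so adjacent diagonal lengths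
differ by at most one; the longer one is the one nearer to content zero, and this switch is the
ground state. -/
theorem isMaya_maya (lam : YoungDiagram) : IsMaya lam.maya := by
  intro c
  have h1 : ∀ m, diagNode (c + 1) m ∈ lam ↔ m < lam.diagLen (c + 1) := lam.diagNode_mem_iff _
  have h2 : ∀ m, diagNode c m ∈ lam ↔ m < lam.diagLen c := lam.diagNode_mem_iff _
  rw [occ, maya_apply]
  rcases le_or_gt 0 c with hc | hc
  · have h3 : lam.diagLen (c + 1) ≤ lam.diagLen c := by
      by_contra! hlt
      exact absurd ((h2 _).mp (lam.up_left_mem (by omega) (by omega) ((h1 _).mpr hlt))) (lt_irrefl _)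
    have h4 : lam.diagLen c ≤ lam.diagLen (c + 1) + 1 := by
      by_contra! hlt
      exact absurd ((h1 _).mp (lam.up_left_mem (by omega) (by omega) ((h2 _).mpr hlt))) (lt_irrefl _)
    simp only [not_lt.mpr hc, if_false]
    omega
  · have h3 : lam.diagLen c ≤ lam.diagLen (c + 1) := by
      by_contra! hlt
      exact absurd ((h1 _).mp (lam.up_left_mem (by omega) (by omega) ((h2 _).mpr hlt))) (lt_irrefl _)
    have h4 : lam.diagLen (c + 1) ≤ lam.diagLen c + 1 := by
      by_contra! hlt
      exact absurd ((h2 _).mp (lam.up_left_mem (by omega) (by omega) ((h1 _).mpr hlt))) (lt_irrefl _)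
    simp only [hc, if_true]
    omega

/-- The diagonal lengths have to be the tail sums of `f`. Consecutive tail sums differ by a value of
`f`, and the bead condition on these values makes the resulting set of nodes a lower set. -/
theorem exists_maya_eq {f : ℤ →₀ ℤ} (hf : IsMaya f) (h0 : pairing (fun _ => 1) f = 0) :
    ∃ lam : YoungDiagram, lam.maya = f := by
  classical
  obtain ⟨N, hN⟩ : ∃ N : ℤ, ∀ x, f x ≠ 0 → -N ≤ x ∧ x ≤ N := by
    refine ⟨∑ x ∈ f.support, |x|, fun x hx => abs_le.mp ?_⟩
    exact Finset.single_le_sum (f := fun x : ℤ => |x|) (fun _ _ => abs_nonneg _)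
      (Finsupp.mem_support_iff.mpr hx)
  have hnn := hf.tailSum_nonneg h0
  have hout : ∀ c, tailSum f c ≠ 0 → -N ≤ c ∧ c ≤ N := by
    intro c hc
    by_contra hcon
    rcases not_and_or.mp hcon with h | h
    · refine hc ?_
      rw [← h0, tailSum, pairing_eq_sum, pairing_eq_sum]
      refine Finset.sum_congr rfl fun x hx => ?_
      have := hN x (Finsupp.mem_support_iff.mp hx)
      rw [if_pos (by omega)]
    · refine hc ?_
      rw [tailSum, pairing_eq_sum]
      refine Finset.sum_eq_zero fun x hx => ?_
      have := hN x (Finsupp.mem_support_iff.mp hx)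
      rw [if_neg (by omega), mul_zero]
  let S : Finset (ℕ × ℕ) := (Finset.Icc (-N) N).biUnion fun c =>
    (Finset.range (tailSum f c).toNat).image (diagNode c)
  have hS : ∀ x : ℕ × ℕ, x ∈ S ↔ (min x.1 x.2 : ℕ) < tailSum f (nodeContent x) := by
    intro x
    simp only [S, Finset.mem_biUnion, Finset.mem_Icc, Finset.mem_image, Finset.mem_range]
    constructor
    · rintro ⟨c, -, m, hm, rfl⟩
      rw [nodeContent_diagNode]
      simp only [diagNode]
      omega
    · intro hx
      exact ⟨_, hout _ (by omega), _, by omega, diagNode_nodeContent x⟩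
  have hstep1 : ∀ r c : ℕ, (r + 1, c) ∈ S → (r, c) ∈ S := by
    intro r c h
    rw [hS] at h ⊢
    simp only [nodeContent] at h ⊢
    push_cast at h
    have e := tailSum_sub f ((c : ℤ) - (r + 1))
    rw [show (c : ℤ) - (r + 1) + 1 = c - r by ring] at e
    rcases le_or_gt 0 ((c : ℤ) - (r + 1)) with hc | hc
    · have := hf.of_nonneg hc
      omega
    · have := hf.of_neg hc
      omega
  have hstep2 : ∀ r c : ℕ, (r, c + 1) ∈ S → (r, c) ∈ S := by
    intro r c h
    rw [hS] at h ⊢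
    simp only [nodeContent] at h ⊢
    push_cast at h
    have e := tailSum_sub f ((c : ℤ) - r)
    rw [show (c : ℤ) - r + 1 = c + 1 - r by ring] at e
    rcases le_or_gt 0 ((c : ℤ) - r) with hc | hc
    · have := hf.of_nonneg hc
      omega
    · have := hf.of_neg hc
      omega
  have hlow : IsLowerSet (S : Set (ℕ × ℕ)) := by
    rintro ⟨r, c⟩ ⟨r', c'⟩ hle h
    obtain ⟨hr, hc⟩ := Prod.mk_le_mk.mp hle
    obtain ⟨a, rfl⟩ := Nat.exists_eq_add_of_le hr
    obtain ⟨b, rfl⟩ := Nat.exists_eq_add_of_le hc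
    have h' : (r' + a, c' + b) ∈ S := h
    have h'' : (r', c' + b) ∈ S := by
      clear h hle hr hc
      induction a with
      | zero => exact h'
      | succ a ih => exact ih (hstep1 _ _ h')
    clear h h' hle hc hr
    induction b with
    | zero => exact h''
    | succ b ih => exact ih (hstep2 _ _ h'')
  refine ⟨⟨S, hlow⟩, ?_⟩
  have hdl : ∀ c, ((⟨S, hlow⟩ : YoungDiagram).diagLen c : ℤ) = tailSum f c := by
    intro c
    have key : ∀ m : ℕ, m < (⟨S, hlow⟩ : YoungDiagram).diagLen c ↔ (m : ℤ) < tailSum f c := by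
      intro m
      rw [← diagNode_mem_iff, mem_mk, hS, nodeContent_diagNode]
      simp only [diagNode]
      omega
    have k1 := key ((⟨S, hlow⟩ : YoungDiagram).diagLen c)
    have k2 := key (tailSum f c).toNat
    have := hnn c
    omega
  ext c
  rw [maya_apply, hdl, hdl, tailSum_sub]

theorem diagLen_transpose (lam : YoungDiagram) (c : ℤ) :
    lam.transpose.diagLen c = lam.diagLen (-c) := by
  have key : ∀ m : ℕ, m < lam.transpose.diagLen c ↔ m < lam.diagLen (-c) := by
    intro m
    rw [← diagNode_mem_iff, ← diagNode_mem_iff, mem_transpose]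
    simp [diagNode]
  have k1 := key (lam.transpose.diagLen c)
  have k2 := key (lam.diagLen (-c))
  omega

theorem maya_transpose (lam : YoungDiagram) (c : ℤ) :
    lam.transpose.maya c = - lam.maya (-1 - c) := by
  rw [maya_apply, maya_apply, diagLen_transpose, diagLen_transpose]
  rw [show -1 - c + 1 = -c by ring, show -(c + 1) = -1 - c by ring]
  ring

theorem card_transpose (lam : YoungDiagram) : lam.transpose.card = lam.card := by
  simp [YoungDiagram.card, transpose]

end YoungDiagram

/-! ### Rim hooks and bead moves -/

theorem sum_Ico_single_sub_single (a : ℤ) (k : ℕ) :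
    ∑ c ∈ Finset.Ico a (a + k), (Finsupp.single c (1 : ℤ) - Finsupp.single (c - 1) 1) =
      Finsupp.single (a + k - 1) 1 - Finsupp.single (a - 1) 1 := by
  induction k with
  | zero => simp
  | succ k ih =>
    have : Finset.Ico a (a + (k + 1 : ℕ)) = insert (a + k) (Finset.Ico a (a + k)) := by
      ext x
      simp only [Finset.mem_Ico, Finset.mem_insert]
      omega
    rw [this, Finset.sum_insert (by simp), ih]
    push_cast
    rw [show a + ((k : ℤ) + 1) - 1 = a + k by ring]
    abel

/-- A finite set of integers without internal gaps is an interval. -/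
theorem Int.finset_eq_Ico_of_no_gap {A : Finset ℤ} (hne : A.Nonempty)
    (h : ∀ p ∈ A, ∀ r ∈ A, ∀ q, p ≤ q → q ≤ r → q ∈ A) :
    ∃ a : ℤ, A = Finset.Ico a (a + A.card) := by
  have hA : A = Finset.Ico (A.min' hne) (A.max' hne + 1) := by
    ext x
    simp only [Finset.mem_Ico]
    constructor
    · intro hx
      have h1 := A.min'_le x hx
      have h2 := A.le_max' x hx
      omega
    · rintro ⟨h1, h2⟩
      exact h _ (A.min'_mem hne) _ (A.max'_mem hne) x h1 (by omega)
  refine ⟨A.min' hne, ?_⟩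
  have hc : (A.card : ℤ) = A.max' hne + 1 - A.min' hne := by
    have h1 := congrArg Finset.card hA
    rw [Int.card_Ico] at h1
    have h2 := A.min'_le _ (A.max'_mem hne)
    omega
  rw [hc]
  convert hA using 2
  ring

theorem nodeContent_sub_of_adj {x y : ℕ × ℕ} (h : (SimpleGraph.hasse (ℕ × ℕ)).Adj x y) :
    nodeContent y = nodeContent x + 1 ∨ nodeContent y = nodeContent x - 1 := by
  obtain ⟨a, b⟩ := x
  obtain ⟨c, d⟩ := y
  rw [SimpleGraph.hasse_adj, Prod.mk_covBy_mk_iff, Prod.mk_covBy_mk_iff] at h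
  simp only [Nat.covBy_iff_add_one_eq, nodeContent] at *
  omega

namespace IsRimHookRemoval

variable {k : ℕ} {lam mu : YoungDiagram}

theorem pos (h : IsRimHookRemoval k lam mu) : 0 < k := by
  obtain ⟨x, hx⟩ := h.connected.nonempty
  rw [← h.card_eq]
  exact Finset.card_pos.mpr ⟨x, hx⟩

/-- Of two removed nodes on one diagonal, the earlier one would have its lower right neighbour in
`lam`, against the rim condition. -/
theorem injOn_nodeContent (h : IsRimHookRemoval k lam mu) :
    Set.InjOn nodeContent (lam.cells \ mu.cells : Finset (ℕ × ℕ)) := by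
  have key : ∀ x ∈ lam.cells \ mu.cells, ∀ y ∈ lam.cells \ mu.cells,
      nodeContent x = nodeContent y → ¬ x.1 < y.1 := by
    intro x hx y hy hxy hlt
    refine h.rim x hx ?_
    have hy' := (Finset.mem_sdiff.mp hy).1
    rw [YoungDiagram.mem_cells] at hy' ⊢
    simp only [nodeContent] at hxy
    exact lam.up_left_mem (by omega) (by omega) hy'
  intro x hx y hy hxy
  have h1 := key x hx y hy hxy
  have h2 := key y hy x hx hxy.symm
  simp only [nodeContent] at hxy
  ext <;> omega

/-- Contents change by one along an edge, so a path cannot jump over a missing content. The contents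
of a rim hook thus form an interval, and the sum over its nodes telescopes. -/
theorem no_gap (h : IsRimHookRemoval k lam mu) {x y : ℕ × ℕ} (hx : x ∈ lam.cells \ mu.cells)
    (hy : y ∈ lam.cells \ mu.cells) {q : ℤ} (hq : nodeContent x ≤ q) (hq' : q ≤ nodeContent y) :
    ∃ z ∈ lam.cells \ mu.cells, nodeContent z = q := by
  by_contra! hcon
  obtain ⟨w⟩ := h.connected.preconnected ⟨x, hx⟩ ⟨y, hy⟩
  have key : ∀ u v : {z // z ∈ ((lam.cells \ mu.cells : Finset (ℕ × ℕ)) : Set (ℕ × ℕ))},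
      ((SimpleGraph.hasse (ℕ × ℕ)).induce
        ((lam.cells \ mu.cells : Finset (ℕ × ℕ)) : Set (ℕ × ℕ))).Walk u v →
      nodeContent u.1 < q → nodeContent v.1 < q := by
    intro u v p
    induction p with
    | nil => exact id
    | @cons a b c hab _ ih =>
      intro ha
      refine ih ?_
      have := nodeContent_sub_of_adj (SimpleGraph.induce_adj.mp hab)
      have hne := hcon b.1 b.2
      omega
  have := key _ _ w (lt_of_le_of_ne hq (hcon x hx))
  exact absurd this (not_lt.mpr hq')

/-- Removing a rim `k`-hook moves one bead down by `k`. -/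
theorem exists_maya_eq (h : IsRimHookRemoval k lam mu) :
    ∃ x, mu.maya = moveBead lam.maya x (x - k) := by
  classical
  have hsum : lam.maya - mu.maya = ∑ c ∈ (lam.cells \ mu.cells).image nodeContent,
      (Finsupp.single c 1 - Finsupp.single (c - 1) 1) := by
    rw [Finset.sum_image h.injOn_nodeContent, YoungDiagram.maya, YoungDiagram.maya,
      sub_eq_iff_eq_add, Finset.sum_sdiff (YoungDiagram.cells_subset_iff.mpr h.le)]
  have hcard : ((lam.cells \ mu.cells).image nodeContent).card = k := by
    rw [Finset.card_image_of_injOn h.injOn_nodeContent, h.card_eq]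
  obtain ⟨a, ha⟩ := Int.finset_eq_Ico_of_no_gap
    (A := (lam.cells \ mu.cells).image nodeContent)
    (by rw [← Finset.card_pos, hcard]; exact h.pos) (by
      intro p hp r hr q hpq hqr
      obtain ⟨x, hx, rfl⟩ := Finset.mem_image.mp hp
      obtain ⟨y, hy, rfl⟩ := Finset.mem_image.mp hr
      obtain ⟨z, hz, rfl⟩ := h.no_gap hx hy hpq hqr
      exact Finset.mem_image_of_mem _ hz)
  rw [ha, hcard, sum_Ico_single_sub_single] at hsum
  refine ⟨a + k - 1, ?_⟩
  rw [moveBead, show a + (k : ℤ) - 1 - k = a - 1 by ring, ← sub_sub_cancel lam.maya mu.maya, hsum]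
  abel

end IsRimHookRemoval

/-- Moving one bead down by `k` removes a rim `k`-hook. -/
theorem isRimHookRemoval_of_moveBead {k : ℕ} (hk : 0 < k) {lam mu : YoungDiagram} {x : ℤ}
    (h : mu.maya = moveBead lam.maya x (x - k)) : IsRimHookRemoval k lam mu := by
  have hdl : ∀ c, (lam.diagLen c : ℤ) = mu.diagLen c + if x - k < c ∧ c ≤ x then 1 else 0 := by
    intro c
    rw [← YoungDiagram.tailSum_maya, ← YoungDiagram.tailSum_maya, h, tailSum, tailSum,
      pairing_moveBead]
    split_ifs <;> omega
  have hle : mu ≤ lam := by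
    intro z hz
    rw [YoungDiagram.mem_iff_lt_diagLen] at hz ⊢
    have := hdl (nodeContent z)
    split_ifs at this <;> omega
  have hmem : ∀ z, z ∈ lam.cells \ mu.cells ↔ min z.1 z.2 = mu.diagLen (nodeContent z) ∧
      x - k < nodeContent z ∧ nodeContent z ≤ x := by
    intro z
    rw [Finset.mem_sdiff, YoungDiagram.mem_cells, YoungDiagram.mem_cells,
      YoungDiagram.mem_iff_lt_diagLen, YoungDiagram.mem_iff_lt_diagLen]
    have := hdl (nodeContent z)
    split_ifs at this <;> omega
  have hnode : ∀ c : ℤ, x - k < c → c ≤ x →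
      diagNode c (mu.diagLen c) ∈ lam.cells \ mu.cells := by
    intro c h1 h2
    rw [hmem, nodeContent_diagNode]
    refine ⟨?_, h1, h2⟩
    simp only [diagNode]
    omega
  refine ⟨hle, ?_, ?_, ?_⟩
  · have h1 : (lam.card : ℤ) = mu.card + k := by
      rw [← YoungDiagram.pairing_id_maya, ← YoungDiagram.pairing_id_maya, h, pairing_moveBead]
      ring
    rw [Finset.card_sdiff_of_subset (YoungDiagram.cells_subset_iff.mpr hle)]
    simp only [YoungDiagram.card] at h1
    omega
  · rw [SimpleGraph.connected_iff_exists_forall_reachable]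
    refine ⟨⟨_, hnode x (by omega) le_rfl⟩, ?_⟩
    have key : ∀ (n : ℕ) (hn : x - k < x - n),
        ((SimpleGraph.hasse (ℕ × ℕ)).induce
          ((lam.cells \ mu.cells : Finset (ℕ × ℕ)) : Set (ℕ × ℕ))).Reachable
        ⟨_, hnode x (by omega) le_rfl⟩ ⟨_, hnode (x - n) hn (by omega)⟩ := by
      intro n
      induction n with
      | zero =>
        intro hn
        have : x - ((0 : ℕ) : ℤ) = x := by simp
        simp only [this]
        exact SimpleGraph.Reachable.refl _
      | succ n ih =>
        intro hn
        push_cast at hn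
        refine (ih (by omega)).trans (SimpleGraph.Adj.reachable ?_)
        rw [SimpleGraph.induce_adj]
        -- The next node has to share an edge with the present one. This is the bead condition on
        -- `lam`: consecutive last nodes differ by exactly one step left or down.
        have hm := lam.isMaya_maya (x - (n + 1 : ℕ))
        rw [occ, YoungDiagram.maya_apply, hdl, hdl, if_pos (by push_cast; omega),
          if_pos (by push_cast; omega)] at hm
        push_cast at hm ⊢
        rw [show x - ((n : ℤ) + 1) + 1 = x - n by ring] at hm
        simp only [diagNode]
        rw [SimpleGraph.hasse_adj, Prod.mk_covBy_mk_iff, Prod.mk_covBy_mk_iff]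
        simp only [Nat.covBy_iff_add_one_eq]
        split_ifs at hm <;> omega
    rintro ⟨z, hz⟩
    have hz' := (hmem z).mp hz
    have := key (x - nodeContent z).toNat (by omega)
    convert this using 2
    rw [Int.toNat_of_nonneg (by omega), sub_sub_cancel, ← hz'.1, diagNode_nodeContent]
  · intro z hz
    have hz' := (hmem z).mp hz
    have h1 := hdl (nodeContent z)
    rw [if_pos hz'.2] at h1
    rw [YoungDiagram.mem_cells, YoungDiagram.mem_iff_lt_diagLen]
    have h2 : nodeContent (z.1 + 1, z.2 + 1) = nodeContent z := by
      simp only [nodeContent]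
      push_cast
      ring
    rw [h2]
    simp only
    omega

/-! ### Charges modulo `s` and cores -/

/-- `f` and `g` have the same total on every residue class modulo `s`. -/
def SameCharge (s : ℕ) (f g : ℤ →₀ ℤ) : Prop :=
  ∀ w : ℤ → ℤ, (∀ x y, x ≡ y [ZMOD s] → w x = w y) → pairing w f = pairing w g

theorem SameCharge.refl (s : ℕ) (f : ℤ →₀ ℤ) : SameCharge s f f := fun _ _ => rfl

theorem SameCharge.symm {s : ℕ} {f g : ℤ →₀ ℤ} (h : SameCharge s f g) : SameCharge s g f :=
  fun w hw => (h w hw).symm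

theorem SameCharge.trans {s : ℕ} {f g k : ℤ →₀ ℤ} (h : SameCharge s f g)
    (h' : SameCharge s g k) : SameCharge s f k := fun w hw => (h w hw).trans (h' w hw)

theorem SameCharge.total {s : ℕ} {f g : ℤ →₀ ℤ} (h : SameCharge s f g) :
    pairing (fun _ => 1) f = pairing (fun _ => 1) g := h _ fun _ _ _ => rfl

theorem sameCharge_moveBead {s : ℕ} (f : ℤ →₀ ℤ) {x y : ℤ} (h : x ≡ y [ZMOD s]) :
    SameCharge s (moveBead f x y) f := by
  intro w hw
  rw [pairing_moveBead, hw x y h]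
  ring

/-- Every bead has a bead `s` positions below it. -/
def IsFlush (s : ℕ) (f : ℤ →₀ ℤ) : Prop := ∀ x, occ f x = 1 → occ f (x - s) = 1

theorem IsFlush.sub_mul {s : ℕ} {f : ℤ →₀ ℤ} (h : IsFlush s f) {x : ℤ} (hx : occ f x = 1) (n : ℕ) :
    occ f (x - n * s) = 1 := by
  induction n with
  | zero => simpa using hx
  | succ n ih =>
    have := h _ ih
    rw [← this]
    congr 1
    push_cast
    ring

/-- Suppose `f` has a bead at `x` and `g` does not. Flushness puts a bead of `f` at every position
of the class below `x` and none of `g` above, so `f - g` is nonnegative on the class and positive at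
`x`, contradicting equal charges. -/
theorem eq_of_isFlush {s : ℕ} {f g : ℤ →₀ ℤ} (hf : IsMaya f) (hg : IsMaya g)
    (hf' : IsFlush s f) (hg' : IsFlush s g) (h : SameCharge s f g) : f = g := by
  classical
  have key : ∀ {f g : ℤ →₀ ℤ}, IsMaya f → IsMaya g → IsFlush s f → IsFlush s g →
      SameCharge s f g → ∀ x, ¬ (occ f x = 1 ∧ occ g x = 0) := by
    intro f g hf hg hf' hg' h x ⟨hx1, hx0⟩
    have h1 := h (fun y => if y ≡ x [ZMOD s] then 1 else 0) (by
      intro y z hyz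
      have : y ≡ x [ZMOD s] ↔ z ≡ x [ZMOD s] := ⟨hyz.symm.trans, hyz.trans⟩
      simp only [this])
    rw [← sub_eq_zero, ← map_sub] at h1
    have h2 := mul_eq_zero_of_pairing_eq_zero (x := x) ?_ h1
    · simp only [Finsupp.sub_apply, Int.ModEq.refl, if_true, ← occ_sub_occ] at h2
      omega
    · intro y
      split_ifs with hy
      · rw [Finsupp.sub_apply, ← occ_sub_occ]
        obtain ⟨c, hc⟩ := hy.dvd
        rcases le_or_gt 0 c with h0 | h0
        · have := hf'.sub_mul hx1 c.toNat
          rw [Int.toNat_of_nonneg h0, show x - c * s = y by linarith] at this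
          rcases hg y with h | h <;> omega
        · have : occ g y ≠ 1 := by
            intro hcon
            have := hg'.sub_mul hcon (-c).toNat
            rw [Int.toNat_of_nonneg (by omega), show y - -c * s = x by linarith] at this
            omega
          rcases hg y with h | h <;> rcases hf y with h' | h' <;> omega
      · simp
  refine ext_of_occ fun x => ?_
  have k1 := key hf hg hf' hg' h x
  have k2 := key hg hf hg' hf' h.symm x
  rcases hf x with h | h <;> rcases hg x with h' | h' <;> omega

theorem IsCorePartition.isFlush {s : ℕ} (hs : 0 < s) {lam : YoungDiagram}
    (h : IsCorePartition s lam) : IsFlush s lam.maya := by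
  intro x hx
  by_contra hcon
  have h0 : occ lam.maya (x - s) = 0 := (lam.isMaya_maya _).resolve_right hcon
  obtain ⟨mu, hmu⟩ := YoungDiagram.exists_maya_eq (lam.isMaya_maya.moveBead hx h0)
    (by rw [pairing_moveBead, lam.pairing_one_maya]; ring)
  exact h mu (isRimHookRemoval_of_moveBead hs hmu)

theorem IsRimHookRemoval.sameCharge {s : ℕ} {lam mu : YoungDiagram}
    (h : IsRimHookRemoval s lam mu) : SameCharge s mu.maya lam.maya := by
  obtain ⟨x, hx⟩ := h.exists_maya_eq
  rw [hx]
  exact sameCharge_moveBead _ (by simp [Int.modEq_iff_dvd])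

theorem IsRimHookRemoval.card_eq_add {s : ℕ} {lam mu : YoungDiagram}
    (h : IsRimHookRemoval s lam mu) : lam.card = mu.card + s := by
  have h1 := h.card_eq
  have h2 := h.card_lt
  rw [Finset.card_sdiff_of_subset (YoungDiagram.cells_subset_iff.mpr h.le)] at h1
  simp only [YoungDiagram.card] at h2 ⊢
  omega

theorem corePart_spec (s : ℕ) (lam : YoungDiagram) :
    IsCorePartition s (corePart s lam) ∧ SameCharge s (corePart s lam).maya lam.maya ∧
      lam.card = (corePart s lam).card + s * coreWeight s lam := by
  induction hn : lam.card using Nat.strong_induction_on generalizing lam with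
  | _ n ih =>
    subst hn
    by_cases h : ∃ mu, IsRimHookRemoval s lam mu
    · obtain ⟨h1, h2, h3⟩ := ih _ h.choose_spec.card_lt h.choose rfl
      rw [corePart, coreWeight, dif_pos h, dif_pos h]
      refine ⟨h1, h2.trans h.choose_spec.sameCharge, ?_⟩
      have := h.choose_spec.card_eq_add
      rw [mul_add, mul_one, ← add_assoc, ← h3]
      exact this
    · rw [corePart, coreWeight, dif_neg h, dif_neg h]
      exact ⟨not_exists.mp h, SameCharge.refl _ _, by simp⟩

/-- This removes the arbitrary choices from the definition of the core: charges are invariant under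
hook removal, and a flush configuration is determined by them. -/
theorem corePart_eq_iff {s : ℕ} (hs : 0 < s) {lam sig : YoungDiagram}
    (hsig : IsFlush s sig.maya) :
    corePart s lam = sig ↔ SameCharge s lam.maya sig.maya := by
  obtain ⟨h1, h2, -⟩ := corePart_spec s lam
  constructor
  · rintro rfl
    exact h2.symm
  · intro h
    exact YoungDiagram.maya_injective (eq_of_isFlush (YoungDiagram.isMaya_maya _)
      (YoungDiagram.isMaya_maya _) (h1.isFlush hs) hsig (h2.trans h))

theorem mem_partitionsWithCores_iff {s t : ℕ} (hs : 0 < s) (ht : 0 < t) {sig tau : YoungDiagram}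
    (hsig : IsFlush s sig.maya) (htau : IsFlush t tau.maya) {n : ℕ} {lam : YoungDiagram} :
    lam ∈ partitionsWithCores s t sig tau n ↔
      lam.card = n ∧ SameCharge s lam.maya sig.maya ∧ SameCharge t lam.maya tau.maya := by
  rw [partitionsWithCores, Set.mem_ofPred_eq, corePart_eq_iff hs hsig, corePart_eq_iff ht htau]

/-! ### Conjugation as the reflection `x ↦ -1 - x` exchanging beads and gaps -/

theorem occ_maya_transpose (lam : YoungDiagram) (x : ℤ) :
    occ lam.transpose.maya x = 1 - occ lam.maya (-1 - x) := by
  simp only [occ, YoungDiagram.maya_transpose]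
  split_ifs <;> omega

theorem IsFlush.transpose {s : ℕ} {lam : YoungDiagram} (h : IsFlush s lam.maya) :
    IsFlush s lam.transpose.maya := by
  intro x hx
  rw [occ_maya_transpose] at hx ⊢
  have h1 : occ lam.maya (-1 - (x - s)) ≠ 1 := by
    intro hcon
    have := h _ hcon
    rw [show -1 - (x - s) - s = -1 - x by ring] at this
    omega
  have := (lam.isMaya_maya (-1 - (x - s))).resolve_right h1
  omega

theorem pairing_maya_transpose (w : ℤ → ℤ) (lam : YoungDiagram) :
    pairing w lam.transpose.maya = - pairing (fun x => w (-1 - x)) lam.maya := by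
  rw [YoungDiagram.pairing_maya, YoungDiagram.pairing_maya, ← Finset.sum_neg_distrib]
  refine Finset.sum_nbij' Prod.swap Prod.swap ?_ ?_ ?_ ?_ ?_
  · intro x hx
    simpa [YoungDiagram.mem_transpose] using hx
  · intro x hx
    simpa [YoungDiagram.mem_transpose] using hx
  · simp
  · simp
  · intro x _
    have h1 : -1 - nodeContent x.swap = nodeContent x - 1 := by
      simp only [nodeContent, Prod.fst_swap, Prod.snd_swap]
      ring
    have h2 : -1 - (nodeContent x.swap - 1) = nodeContent x := by
      simp only [nodeContent, Prod.fst_swap, Prod.snd_swap]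
      ring
    rw [h1, h2]
    ring

theorem SameCharge.transpose {s : ℕ} {lam mu : YoungDiagram}
    (h : SameCharge s lam.maya mu.maya) :
    SameCharge s lam.transpose.maya mu.transpose.maya := by
  intro w hw
  rw [pairing_maya_transpose, pairing_maya_transpose, h]
  intro x y hxy
  exact hw _ _ ((Int.ModEq.refl (-1)).sub hxy)

theorem corePart_transpose {s : ℕ} (hs : 0 < s) (lam : YoungDiagram) :
    corePart s lam.transpose = (corePart s lam).transpose := by
  obtain ⟨h1, h2, -⟩ := corePart_spec s lam
  exact (corePart_eq_iff hs (h1.isFlush hs).transpose).mpr h2.symm.transpose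

/-! ### Integer matrices with prescribed margins and integral potentials -/

section Potentials

variable {ι κ : Type*} [Fintype ι] [Fintype κ]

/-- `e'` is obtained from a matrix with the same margins as `e` by subtracting `u i + v j`. -/
def PotentialEquiv (e e' : ι → κ → ℤ) : Prop :=
  ∃ (u : ι → ℤ) (v : κ → ℤ), (∀ i, ∑ j, (e' i j + (u i + v j)) = ∑ j, e i j) ∧
    ∀ j, ∑ i, (e' i j + (u i + v j)) = ∑ i, e i j

theorem PotentialEquiv.refl (e : ι → κ → ℤ) : PotentialEquiv e e :=
  ⟨0, 0, by simp, by simp⟩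

theorem PotentialEquiv.trans {e e' e'' : ι → κ → ℤ} (h : PotentialEquiv e e')
    (h' : PotentialEquiv e' e'') : PotentialEquiv e e'' := by
  obtain ⟨u, v, h1, h2⟩ := h
  obtain ⟨u', v', h1', h2'⟩ := h'
  refine ⟨fun i => u i + u' i, fun j => v j + v' j, fun i => ?_, fun j => ?_⟩
  · rw [← h1]
    have := h1' i
    simp only [Finset.sum_add_distrib] at this ⊢
    linarith
  · rw [← h2]
    have := h2' j
    simp only [Finset.sum_add_distrib] at this ⊢
    linarith

theorem PotentialEquiv.one_sub {e e' : ι → κ → ℤ} (h : PotentialEquiv e e') :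
    PotentialEquiv (fun i j => 1 - e i j) (fun i j => 1 - e' i j) := by
  obtain ⟨u, v, h1, h2⟩ := h
  refine ⟨fun i => - u i, fun j => - v j, fun i => ?_, fun j => ?_⟩
  · have := h1 i
    simp only [Finset.sum_add_distrib, Finset.sum_sub_distrib, Finset.sum_neg_distrib] at this ⊢
    linarith
  · have := h2 j
    simp only [Finset.sum_add_distrib, Finset.sum_sub_distrib, Finset.sum_neg_distrib] at this ⊢
    linarith

/-- Twice the sum of the binomial coefficients `e i j` choose 2. -/
def excessEnergy (e : ι → κ → ℤ) : ℤ := ∑ i, ∑ j, e i j * (e i j - 1)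

theorem Int.mul_sub_one_nonneg (x : ℤ) : 0 ≤ x * (x - 1) := by
  rcases le_or_gt x 0 with h | h <;> nlinarith

theorem excessEnergy_nonneg (e : ι → κ → ℤ) : 0 ≤ excessEnergy e :=
  Finset.sum_nonneg fun _ _ => Finset.sum_nonneg fun _ _ => Int.mul_sub_one_nonneg _

theorem excessEnergy_one_sub (e : ι → κ → ℤ) :
    excessEnergy (fun i j => 1 - e i j) = excessEnergy e :=
  Finset.sum_congr rfl fun _ _ => Finset.sum_congr rfl fun _ _ => by ring

/-- `e` has the least energy in its class. -/
def IsMinEnergy (e : ι → κ → ℤ) : Prop :=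
  ∀ e', PotentialEquiv e e' → excessEnergy e ≤ excessEnergy e'

/-- The symmetry `e ↦ 1 - e` preserves the energy, so an upper bound on the entries of all minimal
matrices also yields a lower bound. -/
theorem IsMinEnergy.one_sub {e : ι → κ → ℤ} (h : IsMinEnergy e) :
    IsMinEnergy fun i j => 1 - e i j := by
  intro e' he'
  rw [excessEnergy_one_sub, ← excessEnergy_one_sub e']
  refine h _ ?_
  convert he'.one_sub using 3
  ring

theorem IsMinEnergy.of_le {e e' : ι → κ → ℤ} (h : IsMinEnergy e) (he : PotentialEquiv e e')
    (hle : excessEnergy e' ≤ excessEnergy e) : IsMinEnergy e' :=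
  fun _ he'' => hle.trans (h _ (he.trans he''))

theorem exists_isMinEnergy (e : ι → κ → ℤ) : ∃ e', PotentialEquiv e e' ∧ IsMinEnergy e' := by
  classical
  have hex : ∃ n : ℕ, ∃ e', PotentialEquiv e e' ∧ excessEnergy e' = n :=
    ⟨(excessEnergy e).toNat, e, .refl e, (Int.toNat_of_nonneg (excessEnergy_nonneg e)).symm⟩
  obtain ⟨e', he', hn⟩ := Nat.find_spec hex
  refine ⟨e', he', fun e'' he'' => ?_⟩
  rw [hn, ← Int.toNat_of_nonneg (excessEnergy_nonneg e'')]
  exact_mod_cast Nat.find_min' hex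
    ⟨e'', he'.trans he'', (Int.toNat_of_nonneg (excessEnergy_nonneg e'')).symm⟩

/-- The column `j₀` can be reached from row `i` by an alternating path of `k` double steps. -/
def ReachesCol (e : ι → κ → ℤ) (j₀ : κ) : ℕ → ι → Prop
  | 0, i => e i j₀ ≤ 0
  | k + 1, i => ∃ j i', e i j ≤ 0 ∧ 1 ≤ e i' j ∧ ReachesCol e j₀ k i'

variable [DecidableEq ι] [DecidableEq κ]

/-- Add `1` at `(i₀, j₁)`, `(i₁, j₀)` and `-1` at `(i₀, j₀)`, `(i₁, j₁)`. -/
def rectChange (e : ι → κ → ℤ) (i₀ i₁ : ι) (j₀ j₁ : κ) (i : ι) (j : κ) : ℤ :=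
  e i j + ((if i = i₁ then 1 else 0) - if i = i₀ then 1 else 0) *
    ((if j = j₀ then 1 else 0) - if j = j₁ then 1 else 0)

theorem sum_rectChange_row {ι κ : Type*} [Fintype κ] [DecidableEq ι] [DecidableEq κ] (e : ι → κ → ℤ) (i₀ i₁ : ι) (j₀ j₁ : κ) (i : ι) :
    ∑ j, rectChange e i₀ i₁ j₀ j₁ i j = ∑ j, e i j := by
  simp [rectChange, Finset.sum_add_distrib, ← Finset.mul_sum]

theorem sum_rectChange_col {ι κ : Type*} [Fintype ι] [DecidableEq ι] [DecidableEq κ] (e : ι → κ → ℤ) (i₀ i₁ : ι) (j₀ j₁ : κ) (j : κ) :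
    ∑ i, rectChange e i₀ i₁ j₀ j₁ i j = ∑ i, e i j := by
  simp [rectChange, Finset.sum_add_distrib, ← Finset.sum_mul]

theorem potentialEquiv_rectChange (e : ι → κ → ℤ) (i₀ i₁ : ι) (j₀ j₁ : κ) :
    PotentialEquiv e (rectChange e i₀ i₁ j₀ j₁) :=
  ⟨0, 0, by simp [sum_rectChange_row], by simp [sum_rectChange_col]⟩

theorem excessEnergy_rectChange (e : ι → κ → ℤ) {i₀ i₁ : ι} {j₀ j₁ : κ} (hi : i₀ ≠ i₁)
    (hj : j₀ ≠ j₁) : excessEnergy (rectChange e i₀ i₁ j₀ j₁) =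
      excessEnergy e + 2 * (e i₁ j₀ - e i₁ j₁ - e i₀ j₀ + e i₀ j₁) + 4 := by
  set a : ι → ℤ := fun i => (if i = i₁ then 1 else 0) - if i = i₀ then 1 else 0 with ha
  set b : κ → ℤ := fun j => (if j = j₀ then 1 else 0) - if j = j₁ then 1 else 0 with hb
  have h1 : excessEnergy (rectChange e i₀ i₁ j₀ j₁) =
      excessEnergy e + 2 * ∑ i, a i * ∑ j, e i j * b j + (∑ i, a i ^ 2) * ∑ j, b j ^ 2
        - (∑ i, a i) * ∑ j, b j := by
    rw [Finset.sum_mul_sum, Finset.sum_mul_sum]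
    simp only [excessEnergy, Finset.mul_sum, ← Finset.sum_add_distrib, ← Finset.sum_sub_distrib]
    refine Finset.sum_congr rfl fun i _ => Finset.sum_congr rfl fun j _ => ?_
    simp only [rectChange, a, b]
    ring
  have h2 : ∑ i, a i = 0 := by simp [ha]
  have h3 : ∑ i, a i ^ 2 = 2 := by
    have : ∀ i, a i ^ 2 = (if i = i₁ then 1 else 0) + if i = i₀ then 1 else 0 := by
      intro i
      simp only [ha]
      split_ifs with p q
      · exact absurd (q.symm.trans p) hi
      all_goals norm_num
    simp only [this, Finset.sum_add_distrib]
    simp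
  have h4 : ∑ j, b j ^ 2 = 2 := by
    have : ∀ j, b j ^ 2 = (if j = j₀ then 1 else 0) + if j = j₁ then 1 else 0 := by
      intro j
      simp only [hb]
      split_ifs with p q
      · exact absurd (p.symm.trans q) hj
      all_goals norm_num
    simp only [this, Finset.sum_add_distrib]
    simp
  have h5 : ∀ i, ∑ j, e i j * b j = e i j₀ - e i j₁ := by
    intro i
    simp [hb, mul_sub]
  have h6 : ∑ i, a i * (e i j₀ - e i j₁) = e i₁ j₀ - e i₁ j₁ - (e i₀ j₀ - e i₀ j₁) := by
    simp [ha, sub_mul]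
  rw [h1]
  simp only [h5, h6, h2, h3, h4]
  ring

/-- A shortest alternating path is shortened by a rectangle change at its first double step. Either
the energy drops, or it does not change and an entry 2 appears in column `j₀` one double step
further along the path. -/
theorem IsMinEnergy.not_reachesCol : ∀ (k : ℕ) {e : ι → κ → ℤ}, IsMinEnergy e →
    ∀ {i₀ : ι} {j₀ : κ}, 2 ≤ e i₀ j₀ → ¬ ReachesCol e j₀ k i₀ := by
  intro k
  induction k using Nat.strong_induction_on with
  | _ k ih =>
    intro e he i₀ j₀ h2 hP
    rcases k with _ | k
    · simp only [ReachesCol] at hP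
      omega
    obtain ⟨j₁, i₁, h01, h11, hP'⟩ := hP
    have hi : i₀ ≠ i₁ := by rintro rfl; omega
    have hj : j₀ ≠ j₁ := by rintro rfl; omega
    have n0 : ∀ m ≤ k, ¬ ReachesCol e j₀ m i₀ := fun m hm => ih m (by omega) he h2
    have n1 : ∀ m < k, ¬ ReachesCol e j₀ m i₁ := fun m hm h =>
      ih (m + 1) (by omega) he h2 ⟨j₁, i₁, h01, h11, h⟩
    have hG := excessEnergy_rectChange e hi hj
    have heq := potentialEquiv_rectChange e i₀ i₁ j₀ j₁
    rcases k with _ | k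
    · simp only [ReachesCol] at hP'
      have := he _ heq
      omega
    have h10 : 1 ≤ e i₁ j₀ := by
      have := n1 0 (by omega)
      simp only [ReachesCol] at this
      omega
    -- An entry at least 2 at `(i₁, j₀)` already has a shorter path. If the entry is 1, the
    -- rectangle change does not raise the energy and makes it 2.
    rcases h10.lt_or_eq with h10 | h10
    · exact ih (k + 1) (by omega) he h10 hP'
    have hrow : ∀ i, i ≠ i₀ → i ≠ i₁ → ∀ j, rectChange e i₀ i₁ j₀ j₁ i j = e i j := by
      intro i h h' j
      simp [rectChange, h, h']
    -- Only rows `i₀` and `i₁` are modified, and by minimality of the path neither of them occurs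
    -- later on it.
    have htr : ∀ m < k + 1, ∀ i, ReachesCol e j₀ m i →
        ReachesCol (rectChange e i₀ i₁ j₀ j₁) j₀ m i := by
      intro m
      have hne : ∀ m < k + 1, ∀ i, ReachesCol e j₀ m i → i ≠ i₀ ∧ i ≠ i₁ := by
        intro m hm i h
        exact ⟨by rintro rfl; exact n0 m hm.le h, by rintro rfl; exact n1 m hm h⟩
      induction m with
      | zero =>
        intro hm i h
        obtain ⟨a, b⟩ := hne 0 hm i h
        simp only [ReachesCol, hrow i a b] at h ⊢
        exact h
      | succ m ihm =>
        intro hm i h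
        obtain ⟨a, b⟩ := hne _ hm i h
        obtain ⟨j, i', e1, e2, h'⟩ := h
        obtain ⟨a', b'⟩ := hne m (by omega) i' h'
        exact ⟨j, i', by rwa [hrow i a b], by rwa [hrow i' a' b'], ihm (by omega) i' h'⟩
    have hmin : IsMinEnergy (rectChange e i₀ i₁ j₀ j₁) := he.of_le heq (by omega)
    refine ih (k + 1) (by omega) hmin (i₀ := i₁) (j₀ := j₀) ?_ ?_
    · simp only [rectChange, if_true, hi.symm, if_false, hj]
      omega
    · obtain ⟨j₂, i₂, e1, e2, h'⟩ := hP'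
      have a : i₂ ≠ i₀ := by rintro rfl; exact n0 k (by omega) h'
      have b : i₂ ≠ i₁ := by rintro rfl; exact n1 k (by omega) h'
      refine ⟨j₂, i₂, ?_, by rwa [hrow i₂ a b], htr k (by omega) i₂ h'⟩
      have c : j₂ ≠ j₁ := by rintro rfl; omega
      have d : j₂ ≠ j₀ := by rintro rfl; omega
      simpa [rectChange, c, d] using e1

/-- When no alternating path exists, the reachable rows `A` and columns `J` form a cut: entries
outside `A` and inside `J` are at least 1, those inside `A` and outside `J` at most 0. Moving the
potentials by one along the cut lowers the energy at `(i₀, j₀)` and raises it nowhere. -/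
theorem IsMinEnergy.le_one {e : ι → κ → ℤ} (he : IsMinEnergy e) (i₀ : ι) (j₀ : κ) :
    e i₀ j₀ ≤ 1 := by
  classical
  by_contra! h2
  let A : ι → Prop := fun i => ∃ k, ReachesCol e j₀ k i
  let J : κ → Prop := fun j => j = j₀ ∨ ∃ i, A i ∧ 1 ≤ e i j
  have h0 : ¬ A i₀ := fun ⟨k, hk⟩ => he.not_reachesCol k h2 hk
  have hAJ : ∀ i j, ¬ A i → J j → 1 ≤ e i j := by
    intro i j hi hj
    by_contra! hcon
    rcases hj with rfl | ⟨i', ⟨k, hk⟩, h'⟩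
    · exact hi ⟨0, by simp only [ReachesCol]; omega⟩
    · exact hi ⟨k + 1, j, i', by omega, h', hk⟩
  have hAJ' : ∀ i j, A i → ¬ J j → e i j ≤ 0 := by
    intro i j hi hj
    by_contra! hcon
    exact hj (Or.inr ⟨i, hi, hcon⟩)
  let e' : ι → κ → ℤ := fun i j =>
    e i j - (if A i then 0 else 1) + if J j then 0 else 1
  have hle : ∀ i j, e' i j * (e' i j - 1) ≤ e i j * (e i j - 1) := by
    intro i j
    simp only [e']
    split_ifs with hi hj hj
    · simp
    · nlinarith [hAJ' i j hi hj]
    · nlinarith [hAJ i j hi hj]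
    · simp
  have hlt : excessEnergy e' < excessEnergy e := by
    refine Finset.sum_lt_sum (fun i _ => Finset.sum_le_sum fun j _ => hle i j)
      ⟨i₀, Finset.mem_univ _, Finset.sum_lt_sum (fun j _ => hle i₀ j) ⟨j₀, Finset.mem_univ _, ?_⟩⟩
    have hj : J j₀ := Or.inl rfl
    simp only [e', h0, hj, if_true, if_false]
    nlinarith
  refine absurd (he e' ⟨fun i => if A i then 0 else 1, fun j => - if J j then 0 else 1, ?_, ?_⟩)
    (not_le.mpr hlt)
  · intro i
    refine Finset.sum_congr rfl fun j _ => ?_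
    simp only [e']
    ring
  · intro j
    refine Finset.sum_congr rfl fun i _ => ?_
    simp only [e']
    ring

/-- Every integer matrix has the same margins as a matrix of the form `M i j + u i + v j`, where
the entries of `M` are `0` or `1`. -/
theorem exists_zero_one_add_potential (b : ι → κ → ℤ) :
    ∃ (u : ι → ℤ) (v : κ → ℤ) (M : ι → κ → ℤ), (∀ i j, M i j = 0 ∨ M i j = 1) ∧
      (∀ i, ∑ j, (M i j + (u i + v j)) = ∑ j, b i j) ∧
      ∀ j, ∑ i, (M i j + (u i + v j)) = ∑ i, b i j := by
  obtain ⟨M, ⟨u, v, h1, h2⟩, hM⟩ := exists_isMinEnergy b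
  refine ⟨u, v, M, fun i j => ?_, h1, h2⟩
  have k1 := hM.le_one i j
  have k2 := hM.one_sub.le_one i j
  omega

end Potentials

/-! ### Matrices of zeros and ones with prescribed margins -/

section ZeroOne

variable {ι κ : Type*}

/-- All entries of `M` are `0` or `1`. -/
def IsZeroOne (M : ι → κ → ℤ) : Prop := ∀ i j, M i j = 0 ∨ M i j = 1

/-- The rows `i`, `k` and columns `j`, `l` of `M` form a two by two identity matrix. -/
def Interchange (M : ι → κ → ℤ) (i k : ι) (j l : κ) : Prop :=
  M i j = 1 ∧ M k l = 1 ∧ M i l = 0 ∧ M k j = 0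

theorem Interchange.flip {M : ι → κ → ℤ} {i k : ι} {j l : κ} (h : Interchange M i k j l) :
    Interchange M k i l j := ⟨h.2.1, h.1, h.2.2.2, h.2.2.1⟩

theorem Interchange.swap {M : ι → κ → ℤ} {i k : ι} {j l : κ} (h : Interchange M i k j l) :
    Interchange (fun b a => M a b) j l i k := ⟨h.1, h.2.1, h.2.2.2, h.2.2.1⟩

theorem Interchange.ne_row {M : ι → κ → ℤ} {i k : ι} {j l : κ} (h : Interchange M i k j l) :
    i ≠ k := by
  rintro rfl
  have h1 := h.1
  have h2 := h.2.2.2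
  omega

theorem Interchange.ne_col {M : ι → κ → ℤ} {i k : ι} {j l : κ} (h : Interchange M i k j l) :
    j ≠ l := h.swap.ne_row

/-- Up to symmetry, `(i, k, j, l)` is the only interchange of `M`. -/
def OnlyInterchange (M : ι → κ → ℤ) (i k : ι) (j l : κ) : Prop :=
  Interchange M i k j l ∧ ∀ i' k' j' l', Interchange M i' k' j' l' →
    (i' = i ∧ k' = k ∧ j' = j ∧ l' = l) ∨ (i' = k ∧ k' = i ∧ j' = l ∧ l' = j)

theorem OnlyInterchange.flip {M : ι → κ → ℤ} {i k : ι} {j l : κ}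
    (h : OnlyInterchange M i k j l) : OnlyInterchange M k i l j :=
  ⟨h.1.flip, fun i' k' j' l' h' => (h.2 i' k' j' l' h').symm⟩

theorem OnlyInterchange.swap {M : ι → κ → ℤ} {i k : ι} {j l : κ}
    (h : OnlyInterchange M i k j l) : OnlyInterchange (fun b a => M a b) j l i k := by
  refine ⟨h.1.swap, fun a b c d h' => ?_⟩
  have := h.2 c d a b ⟨h'.1, h'.2.1, h'.2.2.2, h'.2.2.1⟩
  tauto

theorem OnlyInterchange.eq_of_ne {M : ι → κ → ℤ} (hM : IsZeroOne M) {i k : ι} {j l : κ}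
    (h : OnlyInterchange M i k j l) {b : κ} (hj : b ≠ j) (hl : b ≠ l) : M i b = M k b := by
  rcases hM i b with h1 | h1 <;> rcases hM k b with h2 | h2
  · rw [h1, h2]
  · rcases h.2 i k j b ⟨h.1.1, h2, h1, h.1.2.2.2⟩ with h' | h'
    · exact absurd h'.2.2.2 hl
    · exact absurd h'.2.2.2 hj
  · rcases h.2 i k b l ⟨h1, h.1.2.1, h.1.2.2.1, h2⟩ with h' | h'
    · exact absurd h'.2.2.1 hj
    · exact absurd h'.2.2.1 hl
  · rw [h1, h2]

/-- A row is closed upwards with respect to the weights `d` of the columns. -/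
def UpClosed (d r : κ → ℤ) : Prop := ∀ a b, r a = 1 → d a ≤ d b → r b = 1

/-- Two sets closed upwards for the same weights are nested, so with equal cardinality they
coincide. -/
theorem UpClosed.eq [Fintype κ] {d r r' : κ → ℤ} (h : UpClosed d r) (h' : UpClosed d r')
    (hr : ∀ a, r a = 0 ∨ r a = 1) (hr' : ∀ a, r' a = 0 ∨ r' a = 1)
    (hsum : ∑ a, r a = ∑ a, r' a) : r = r' := by
  have key : ∀ {r r' : κ → ℤ}, UpClosed d r → UpClosed d r' → (∀ a, r a = 0 ∨ r a = 1) →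
      (∀ a, r' a = 0 ∨ r' a = 1) → ∑ a, r a = ∑ a, r' a → ∀ a, ¬ (r a = 1 ∧ r' a = 0) := by
    intro r r' h h' hr hr' hsum a ⟨h1, h0⟩
    refine absurd hsum.symm (ne_of_lt (Finset.sum_lt_sum (fun b _ => ?_)
      ⟨a, Finset.mem_univ _, by omega⟩))
    rcases hr' b with h2 | h2
    · rcases hr b with h3 | h3 <;> omega
    · have h3 : d a ≤ d b := by
        by_contra! hlt
        have := h' b a h2 hlt.le
        omega
      rw [h2, h a b h1 h3]
  funext a
  have k1 := key h h' hr hr' hsum a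
  have k2 := key h' h hr' hr hsum.symm a
  rcases hr a with h1 | h1 <;> rcases hr' a with h2 | h2 <;> omega

/-- Row `i` contributes more to column `a` than to column `b`; as column `b` has at least as large a
sum, some other row must compensate. -/
theorem exists_interchange [Fintype ι] {M : ι → κ → ℤ} (hM : IsZeroOne M) {i : ι} {a b : κ}
    (ha : M i a = 1) (hb : M i b = 0) (hd : ∑ r, M r a ≤ ∑ r, M r b) :
    ∃ k, Interchange M i k a b := by
  by_contra! hcon
  refine absurd hd (not_le.mpr (Finset.sum_lt_sum (fun r _ => ?_) ⟨i, Finset.mem_univ _, by omega⟩))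
  by_contra! hlt
  refine hcon r ⟨ha, ?_, hb, ?_⟩
  · rcases hM r a with h1 | h1 <;> rcases hM r b with h2 | h2 <;> omega
  · rcases hM r a with h1 | h1 <;> rcases hM r b with h2 | h2 <;> omega

theorem upClosed_of_not_interchange [Fintype ι] {M : ι → κ → ℤ} (hM : IsZeroOne M) {i : ι}
    (h : ∀ k j l, ¬ Interchange M i k j l) : UpClosed (fun j => ∑ r, M r j) (M i) := by
  intro a b ha hd
  rcases hM i b with hb | hb
  · obtain ⟨k, hk⟩ := exists_interchange hM ha hb hd
    exact absurd hk (h k a b)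
  · exact hb

variable [Fintype ι] [Fintype κ]

/-- The two matrices have the same row and column sums. -/
def SameMargins (M N : ι → κ → ℤ) : Prop :=
  (∀ i, ∑ j, M i j = ∑ j, N i j) ∧ ∀ j, ∑ i, M i j = ∑ i, N i j

theorem SameMargins.swap {M N : ι → κ → ℤ} (h : SameMargins M N) :
    SameMargins (fun b a => M a b) (fun b a => N a b) := ⟨h.2, h.1⟩

/-- Twice the difference of `∑ (x choose 2)` between the conjugate of the column sums and the row
sums. -/
def marginGap (M : ι → κ → ℤ) : ℤ :=
  ∑ j, ∑ l, min (∑ i, M i j) (∑ i, M i l) - ∑ i, (∑ j, M i j) ^ 2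

theorem SameMargins.marginGap_eq {M N : ι → κ → ℤ} (h : SameMargins M N) :
    marginGap M = marginGap N := by
  simp only [marginGap, h.1, h.2]

/-- The number of rows with entry `1` in column `j` and entry `0` in column `l`. -/
def colDiff (M : ι → κ → ℤ) (j l : κ) : ℤ := ∑ i, M i j * (1 - M i l)

theorem colDiff_nonneg {ι κ : Type*} [Fintype ι] {M : ι → κ → ℤ} (hM : IsZeroOne M) (j l : κ) :
    0 ≤ colDiff M j l := by
  refine Finset.sum_nonneg fun i _ => ?_
  rcases hM i j with h1 | h1 <;> rcases hM i l with h2 | h2 <;> simp [h1, h2]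

/-- The sum of the squared row sums counts, over pairs of columns, the rows with a one in both.
Subtracting this overlap from both column sums leaves the two one-sided differences, whose minimum
is positive exactly when the pair carries an interchange. -/
theorem marginGap_eq_sum (M : ι → κ → ℤ) :
    marginGap M = ∑ j, ∑ l, min (colDiff M j l) (colDiff M l j) := by
  have h1 : ∑ i, (∑ j, M i j) ^ 2 = ∑ j, ∑ l, ∑ i, M i j * M i l := by
    simp only [sq, Finset.sum_mul_sum]
    rw [Finset.sum_comm]
    exact Finset.sum_congr rfl fun j _ => Finset.sum_comm
  rw [marginGap, h1, ← Finset.sum_sub_distrib]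
  refine Finset.sum_congr rfl fun j _ => ?_
  rw [← Finset.sum_sub_distrib]
  refine Finset.sum_congr rfl fun l _ => ?_
  rw [← min_sub_sub_right]
  congr 1
  · rw [colDiff, ← Finset.sum_sub_distrib]
    exact Finset.sum_congr rfl fun i _ => by ring
  · rw [colDiff, ← Finset.sum_sub_distrib]
    exact Finset.sum_congr rfl fun i _ => by ring

theorem marginGap_nonneg {M : ι → κ → ℤ} (hM : IsZeroOne M) : 0 ≤ marginGap M := by
  rw [marginGap_eq_sum]
  exact Finset.sum_nonneg fun j _ => Finset.sum_nonneg fun l _ =>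
    le_min (colDiff_nonneg hM _ _) (colDiff_nonneg hM _ _)

theorem exists_of_colDiff_pos {ι κ : Type*} [Fintype ι] {M : ι → κ → ℤ} (hM : IsZeroOne M)
    {j l : κ} (h : 1 ≤ colDiff M j l) : ∃ i, M i j = 1 ∧ M i l = 0 := by
  by_contra! hcon
  have : colDiff M j l = 0 := by
    refine Finset.sum_eq_zero fun i _ => ?_
    rcases hM i j with h1 | h1
    · simp [h1]
    · rcases hM i l with h2 | h2
      · exact absurd h2 (hcon i h1)
      · simp [h2]
  omega

theorem exists_interchange_iff {ι κ : Type*} [Fintype ι] {M : ι → κ → ℤ} (hM : IsZeroOne M)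
    (j l : κ) :
    (∃ i k, Interchange M i k j l) ↔ 1 ≤ min (colDiff M j l) (colDiff M l j) := by
  constructor
  · rintro ⟨i, k, h1, h2, h3, h4⟩
    have key : ∀ {i : ι} {j l : κ}, M i j = 1 → M i l = 0 → 1 ≤ colDiff M j l := by
      intro i j l h1 h3
      have := Finset.single_le_sum (f := fun i => M i j * (1 - M i l)) (fun r _ => by
        rcases hM r j with h1 | h1 <;> rcases hM r l with h2 | h2 <;> simp [h1, h2])
        (Finset.mem_univ i)
      simpa [h1, h3, colDiff] using this
    exact le_min (key h1 h3) (key h2 h4)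
  · intro h
    obtain ⟨i, h1, h3⟩ := exists_of_colDiff_pos hM (h.trans (min_le_left _ _))
    obtain ⟨k, h2, h4⟩ := exists_of_colDiff_pos hM (h.trans (min_le_right _ _))
    exact ⟨i, k, h1, h2, h3, h4⟩

theorem not_interchange_of_marginGap_eq_zero {M : ι → κ → ℤ} (hM : IsZeroOne M)
    (h0 : marginGap M = 0) (i k : ι) (j l : κ) : ¬ Interchange M i k j l := by
  intro h
  have hnn : ∀ j l, 0 ≤ min (colDiff M j l) (colDiff M l j) := fun j l =>
    le_min (colDiff_nonneg hM _ _) (colDiff_nonneg hM _ _)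
  rw [marginGap_eq_sum] at h0
  have h1 := (Finset.sum_eq_zero_iff_of_nonneg fun j _ => Finset.sum_nonneg fun l _ => hnn j l).mp
    h0 j (Finset.mem_univ _)
  have h2 := (Finset.sum_eq_zero_iff_of_nonneg fun l _ => hnn j l).mp h1 l (Finset.mem_univ _)
  have h3 := (exists_interchange_iff hM j l).mp ⟨i, k, h⟩
  omega

theorem marginGap_eq_zero_of_not_interchange {M : ι → κ → ℤ} (hM : IsZeroOne M)
    (h : ∀ i k j l, ¬ Interchange M i k j l) : marginGap M = 0 := by
  rw [marginGap_eq_sum]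
  refine Finset.sum_eq_zero fun j _ => Finset.sum_eq_zero fun l _ => ?_
  have h1 := mt (exists_interchange_iff hM j l).mpr (by
    rintro ⟨i, k, h'⟩
    exact h i k j l h')
  have h2 := le_min (colDiff_nonneg hM j l) (colDiff_nonneg hM l j)
  omega

/-- A matrix without interchanges is determined by its margins. -/
theorem eq_of_not_interchange {M N : ι → κ → ℤ} (hM : IsZeroOne M) (hN : IsZeroOne N)
    (hMN : SameMargins M N) (h : ∀ i k j l, ¬ Interchange M i k j l) : M = N := by
  have h0 := marginGap_eq_zero_of_not_interchange hM h
  have h' := not_interchange_of_marginGap_eq_zero hN (hMN.marginGap_eq ▸ h0)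
  funext i
  have hu := upClosed_of_not_interchange hN (h' i)
  simp only [← hMN.2] at hu
  exact (upClosed_of_not_interchange hM (h i)).eq hu (hM i) (hN i) (hMN.1 i)

variable [DecidableEq ι] [DecidableEq κ]

theorem marginGap_of_onlyInterchange {ι κ : Type*} [Fintype ι] [Fintype κ] {M : ι → κ → ℤ} (hM : IsZeroOne M) {i k : ι} {j l : κ}
    (h : OnlyInterchange M i k j l) : marginGap M = 2 := by
  have hcd : ∀ {i k : ι} {j l : κ}, OnlyInterchange M i k j l → colDiff M j l = 1 := by
    intro i k j l h
    rw [colDiff, Finset.sum_eq_single i]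
    · rw [h.1.1, h.1.2.2.1]
      rfl
    · intro r _ hr
      rcases hM r j with h1 | h1
      · simp [h1]
      · rcases hM r l with h2 | h2
        · rcases h.2 r k j l ⟨h1, h.1.2.1, h2, h.1.2.2.2⟩ with h' | h'
          · exact absurd h'.1 hr
          · exact absurd h'.2.2.1 h.1.ne_col
        · simp [h2]
    · simp
  have hz : ∀ a b, (a, b) ≠ (j, l) → (a, b) ≠ (l, j) →
      min (colDiff M a b) (colDiff M b a) = 0 := by
    intro a b h1 h2
    have h3 := mt (exists_interchange_iff hM a b).mpr (by
      rintro ⟨i', k', h'⟩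
      rcases h.2 _ _ _ _ h' with h'' | h''
      · exact h1 (Prod.ext h''.2.2.1 h''.2.2.2)
      · exact h2 (Prod.ext h''.2.2.1 h''.2.2.2))
    have h4 := le_min (colDiff_nonneg hM a b) (colDiff_nonneg hM b a)
    omega
  rw [marginGap_eq_sum, ← Finset.sum_product', Finset.sum_eq_add (j, l) (l, j)]
  · simp only [hcd h, hcd h.flip]
    rfl
  · simp [h.1.ne_col]
  · rintro ⟨a, b⟩ - ⟨h1, h2⟩
    exact hz a b h1 h2
  · simp
  · simp

/-- An interchange in columns `j`, `l` contributes at least one for each of the two orders of the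
pair, which exhausts the gap. -/
theorem unique_pair_of_marginGap_eq_two {ι κ : Type*} [Fintype ι] [Fintype κ] [DecidableEq κ]
    {M : ι → κ → ℤ} (hM : IsZeroOne M)
    (h : marginGap M = 2) : ∃ i k j l, Interchange M i k j l ∧
      ∀ i' k' j' l', Interchange M i' k' j' l' → (j' = j ∧ l' = l) ∨ (j' = l ∧ l' = j) := by
  have hex : ∃ i k j l, Interchange M i k j l := by
    by_contra! hcon
    rw [marginGap_eq_zero_of_not_interchange hM hcon] at h
    omega
  obtain ⟨i, k, j, l, hI⟩ := hex
  refine ⟨i, k, j, l, hI, fun i' k' j' l' h' => ?_⟩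
  by_contra hcon
  rw [marginGap_eq_sum, ← Finset.sum_product'] at h
  have hsub := Finset.sum_le_sum_of_subset_of_nonneg
    (s := {(j, l), (l, j), (j', l')}) (t := Finset.univ ×ˢ Finset.univ)
    (f := fun x : κ × κ => min (colDiff M x.1 x.2) (colDiff M x.2 x.1)) (by simp)
    (fun x _ _ => le_min (colDiff_nonneg hM _ _) (colDiff_nonneg hM _ _))
  have hne := hI.ne_col
  rw [h, Finset.sum_insert, Finset.sum_insert, Finset.sum_singleton] at hsub
  · have h1 := (exists_interchange_iff hM j l).mp ⟨i, k, hI⟩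
    have h2 := (exists_interchange_iff hM l j).mp ⟨k, i, hI.flip⟩
    have h3 := (exists_interchange_iff hM j' l').mp ⟨i', k', h'⟩
    simp only at hsub
    omega
  · simp only [Finset.mem_singleton, Prod.mk.injEq]
    tauto
  · simp only [Finset.mem_insert, Finset.mem_singleton, Prod.mk.injEq]
    tauto

/-- One gap singles out the pair of columns but leaves the rows open, since one of the two column
differences may exceed 1. The gap of the transpose singles out the pair of rows. -/
theorem exists_onlyInterchange_of_marginGap {M : ι → κ → ℤ} (hM : IsZeroOne M)
    (h : marginGap M = 2) (h' : marginGap (fun b a => M a b) = 2) :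
    ∃ i k j l, OnlyInterchange M i k j l := by
  obtain ⟨i, k, j, l, hI, hu⟩ := unique_pair_of_marginGap_eq_two hM h
  obtain ⟨-, -, p, q, -, hv⟩ := unique_pair_of_marginGap_eq_two (fun b a => hM a b) h'
  refine ⟨i, k, j, l, hI, fun i' k' j' l' hI' => ?_⟩
  have h1 := hu _ _ _ _ hI'
  have h2 := hv _ _ _ _ hI.swap
  have h3 := hv _ _ _ _ hI'.swap
  have h4 : ¬ (i' = i ∧ l' = j) := by
    rintro ⟨rfl, rfl⟩
    have e1 := hI.1
    have e2 := hI'.2.2.1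
    omega
  have h5 : ¬ (i' = k ∧ l' = l) := by
    rintro ⟨rfl, rfl⟩
    have e1 := hI.2.1
    have e2 := hI'.2.2.1
    omega
  rcases h1 with ⟨rfl, rfl⟩ | ⟨rfl, rfl⟩ <;> rcases h2 with ⟨rfl, rfl⟩ | ⟨rfl, rfl⟩ <;>
    rcases h3 with ⟨rfl, rfl⟩ | ⟨rfl, rfl⟩ <;> simp_all

theorem Interchange.isZeroOne_rectChange {ι κ : Type*} [DecidableEq ι] [DecidableEq κ]
    {M : ι → κ → ℤ} (hM : IsZeroOne M) {i k : ι} {j l : κ}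
    (h : Interchange M i k j l) : IsZeroOne (rectChange M i k j l) := by
  obtain ⟨h1, h2, h3, h4⟩ := h
  intro a b
  have := hM a b
  rw [rectChange]
  by_cases e1 : a = k <;> by_cases e2 : a = i <;> by_cases e3 : b = j <;> by_cases e4 : b = l <;>
    subst_vars <;> simp_all

theorem Interchange.rectChange_apply {ι κ : Type*} [DecidableEq ι] [DecidableEq κ]
    {M : ι → κ → ℤ} {i k : ι} {j l : κ}
    (h : Interchange M i k j l) : rectChange M i k j l i j = 0 := by
  simp [rectChange, h.ne_row, h.ne_col, h.1]

theorem sameMargins_rectChange (M : ι → κ → ℤ) (i k : ι) (j l : κ) :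
    SameMargins M (rectChange M i k j l) :=
  ⟨fun _ => (sum_rectChange_row ..).symm, fun _ => (sum_rectChange_col ..).symm⟩

/-- Every interchange of `M` must lead to the same matrix `N`, and the places where `M` and `N`
differ reveal the interchange. -/
theorem exists_onlyInterchange_of_two {M N : ι → κ → ℤ} (hM : IsZeroOne M) (hN : IsZeroOne N)
    (hMN : SameMargins M N) (hne : M ≠ N)
    (h : ∀ K, IsZeroOne K → SameMargins M K → K = M ∨ K = N) :
    ∃ i k j l, OnlyInterchange M i k j l := by
  have hex : ∃ i k j l, Interchange M i k j l := by
    by_contra! hcon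
    exact hne (eq_of_not_interchange hM hN hMN hcon)
  obtain ⟨i, k, j, l, hI⟩ := hex
  have key : ∀ {i k j l}, Interchange M i k j l → rectChange M i k j l = N := by
    intro i k j l hI
    refine (h _ (hI.isZeroOne_rectChange hM) (sameMargins_rectChange ..)).resolve_left fun hcon => ?_
    have h1 := hI.rectChange_apply
    rw [hcon, hI.1] at h1
    omega
  refine ⟨i, k, j, l, hI, fun i' k' j' l' hI' => ?_⟩
  have hpos : ∀ {i' k' j' l'}, Interchange M i' k' j' l' → (i' = i ∧ j' = j) ∨ (i' = k ∧ j' = l) := by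
    intro i' k' j' l' hI'
    have h1 := hI'.rectChange_apply
    rw [key hI', ← key hI, rectChange, hI'.1] at h1
    by_cases e1 : i' = k <;> by_cases e2 : i' = i <;> by_cases e3 : j' = j <;>
      by_cases e4 : j' = l <;> simp_all
  have h1 := hpos hI'
  have h2 := hpos hI'.flip
  have h3 := hI'.ne_row
  rcases h1 with ⟨rfl, rfl⟩ | ⟨rfl, rfl⟩ <;> rcases h2 with ⟨rfl, rfl⟩ | ⟨rfl, rfl⟩ <;> simp_all

/-! ### Margins of a matrix with a single interchange -/

theorem OnlyInterchange.upClosed {ι κ : Type*} [Fintype ι] {M : ι → κ → ℤ} (hM : IsZeroOne M) {i k : ι} {j l : κ}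
    (h : OnlyInterchange M i k j l) {r : ι} (hi : r ≠ i) (hk : r ≠ k) :
    UpClosed (fun j => ∑ r, M r j) (M r) := by
  refine upClosed_of_not_interchange hM fun k' j' l' h' => ?_
  rcases h.2 _ _ _ _ h' with h'' | h''
  · exact hi h''.1
  · exact hk h''.1

theorem OnlyInterchange.sum_col_eq {ι κ : Type*} [Fintype ι] {M : ι → κ → ℤ} (hM : IsZeroOne M) {i k : ι} {j l : κ}
    (h : OnlyInterchange M i k j l) : ∑ r, M r j = ∑ r, M r l := by
  rw [← sub_eq_zero, ← Finset.sum_sub_distrib, Finset.sum_eq_add i k h.1.ne_row]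
  · rw [h.1.1, h.1.2.1, h.1.2.2.1, h.1.2.2.2]
    rfl
  · intro r _ hr
    rw [sub_eq_zero]
    exact h.swap.eq_of_ne (fun a b => hM b a) hr.1 hr.2
  · simp
  · simp

/-- Columns `j` and `l` have equal sums, so an upward closed row has the same entry in both, unlike
row `i` of `M`. Equality of the row sums then gives another column where the rows differ, and with
it a second interchange in row `i`. -/
theorem OnlyInterchange.not_upClosed {ι κ : Type*} [Fintype ι] [Fintype κ] {M : ι → κ → ℤ} (hM : IsZeroOne M) {i k : ι} {j l : κ}
    (h : OnlyInterchange M i k j l) {r : κ → ℤ} (hr : ∀ a, r a = 0 ∨ r a = 1)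
    (hsum : ∑ a, r a = ∑ a, M i a) : ¬ UpClosed (fun j => ∑ r, M r j) r := by
  intro hu
  have hd := h.sum_col_eq hM
  rcases hr j with hj | hj
  · have hl : r l = 0 := (hr l).resolve_right fun hl => by
      have := hu l j hl hd.ge
      omega
    obtain ⟨a, ha1, ha0⟩ : ∃ a, r a = 1 ∧ M i a = 0 := by
      by_contra! hcon
      refine absurd hsum (ne_of_lt (Finset.sum_lt_sum (fun b _ => ?_)
        ⟨j, Finset.mem_univ _, by rw [hj, h.1.1]; norm_num⟩))
      have := hcon b
      rcases hr b with h1 | h1 <;> rcases hM i b with h2 | h2 <;> omega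
    have hlt : ∑ r, M r j ≤ ∑ r, M r a := by
      by_contra! hlt
      have := hu a j ha1 hlt.le
      omega
    obtain ⟨k', hk'⟩ := exists_interchange hM h.1.1 ha0 hlt
    rcases h.2 _ _ _ _ hk' with h' | h'
    · rw [h'.2.2.2] at ha1
      omega
    · exact h.1.ne_row h'.1
  · have hl : r l = 1 := hu j l hj hd.le
    obtain ⟨a, ha1, ha0⟩ : ∃ a, M i a = 1 ∧ r a = 0 := by
      by_contra! hcon
      refine absurd hsum.symm (ne_of_lt (Finset.sum_lt_sum (fun b _ => ?_)
        ⟨l, Finset.mem_univ _, by rw [hl, h.1.2.2.1]; norm_num⟩))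
      have := hcon b
      rcases hr b with h1 | h1 <;> rcases hM i b with h2 | h2 <;> omega
    have hlt : ∑ r, M r a ≤ ∑ r, M r l := by
      by_contra! hlt
      have := hu l a hl hlt.le
      omega
    obtain ⟨k', hk'⟩ := exists_interchange hM ha1 h.1.2.2.1 hlt
    rcases h.2 _ _ _ _ hk' with h' | h'
    · rw [h'.2.2.1] at ha0
      omega
    · exact h.1.ne_row h'.1

/-- A matrix with only one interchange shares its margins with exactly one other matrix. -/
theorem OnlyInterchange.eq_or_eq {M N : ι → κ → ℤ} (hM : IsZeroOne M) (hN : IsZeroOne N)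
    (hMN : SameMargins M N) {i k : ι} {j l : κ} (h : OnlyInterchange M i k j l) :
    N = M ∨ N = rectChange M i k j l := by
  obtain ⟨i₂, k₂, j₂, l₂, h₂⟩ := exists_onlyInterchange_of_marginGap hN
    (hMN.marginGap_eq ▸ marginGap_of_onlyInterchange hM h)
    (hMN.swap.marginGap_eq ▸ marginGap_of_onlyInterchange (fun b a => hM a b) h.swap)
  have hup : ∀ r, r ≠ i₂ → r ≠ k₂ → UpClosed (fun j => ∑ r, M r j) (N r) := by
    intro r h1 h2
    have := h₂.upClosed hN h1 h2
    simpa only [← hMN.2] using this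
  -- All rows of `N` outside its own interchange are upward closed, which row `i` cannot be. So both
  -- interchanges use the same two rows, and the remaining rows are determined by the margins.
  have hi : i = i₂ ∨ i = k₂ := by
    by_contra! hcon
    exact h.not_upClosed hM (hN i) (hMN.1 i).symm (hup i hcon.1 hcon.2)
  have hk : k = i₂ ∨ k = k₂ := by
    by_contra! hcon
    exact h.flip.not_upClosed hM (hN k) (hMN.1 k).symm (hup k hcon.1 hcon.2)
  have hik := h.1.ne_row
  have hjl := h.1.ne_col
  have hrow : ∀ r, r ≠ i → r ≠ k → N r = M r := by
    intro r h1 h2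
    refine ((h.upClosed hM h1 h2).eq (hup r ?_ ?_) (hM r) (hN r) (hMN.1 r)).symm
    · rintro rfl
      rcases hi with rfl | rfl <;> rcases hk with rfl | rfl <;> simp_all
    · rintro rfl
      rcases hi with rfl | rfl <;> rcases hk with rfl | rfl <;> simp_all
  have hcol : ∀ b, N i b + N k b = M i b + M k b := by
    intro b
    have h1 : ∑ r, (N r b - M r b) = 0 := by
      rw [Finset.sum_sub_distrib, hMN.2, sub_self]
    rw [Finset.sum_eq_add i k hik] at h1
    · linarith
    · intro r _ hr
      rw [hrow r hr.1 hr.2, sub_self]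
    · simp
    · simp
  have hsame : ∀ b, b ≠ j → b ≠ l → N i b = M i b ∧ N k b = M k b := by
    intro b h1 h2
    have e1 := h.eq_of_ne hM h1 h2
    have e2 := hcol b
    rcases hN i b with e3 | e3 <;> rcases hN k b with e4 | e4 <;> rcases hM i b with e5 | e5 <;>
      omega
  have hrs : N i j + N i l = 1 := by
    have h1 : ∑ b, (N i b - M i b) = 0 := by
      rw [Finset.sum_sub_distrib, hMN.1, sub_self]
    rw [Finset.sum_eq_add j l hjl] at h1
    · rw [h.1.1, h.1.2.2.1] at h1
      linarith
    · intro r _ hr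
      rw [(hsame r hr.1 hr.2).1, sub_self]
    · simp
    · simp
  have hcj := hcol j
  have hcl := hcol l
  rw [h.1.1, h.1.2.2.2] at hcj
  rw [h.1.2.1, h.1.2.2.1] at hcl
  rcases hN i j with hij | hij
  · right
    funext a b
    by_cases h1 : a = i
    · subst h1
      by_cases h3 : b = j
      · subst h3
        simp only [rectChange, hik, hjl, if_true, if_false, hij, h.1.1]
        rfl
      · by_cases h4 : b = l
        · subst h4
          simp only [rectChange, hik, h3, if_true, if_false, h.1.2.2.1]
          omega
        · simp only [rectChange, h3, h4, if_false, (hsame b h3 h4).1]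
          simp
    · by_cases h2 : a = k
      · subst h2
        by_cases h3 : b = j
        · subst h3
          simp only [rectChange, h1, hjl, if_true, if_false, h.1.2.2.2]
          omega
        · by_cases h4 : b = l
          · subst h4
            simp only [rectChange, h1, h3, if_true, if_false, h.1.2.1]
            omega
          · simp only [rectChange, h3, h4, if_false, (hsame b h3 h4).2]
            simp
      · simp [rectChange, h1, h2, hrow a h1 h2]
  · left
    funext a b
    by_cases h1 : a = i
    · subst h1
      by_cases h3 : b = j
      · subst h3
        rw [hij, h.1.1]
      · by_cases h4 : b = l
        · subst h4
          rw [h.1.2.2.1]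
          omega
        · exact (hsame b h3 h4).1
    · by_cases h2 : a = k
      · subst h2
        by_cases h3 : b = j
        · subst h3
          rw [h.1.2.2.2]
          omega
        · by_cases h4 : b = l
          · subst h4
            rw [h.1.2.1]
            omega
          · exact (hsame b h3 h4).2
      · rw [hrow a h1 h2]

end ZeroOne

/-! ### Coordinates for the integers modulo `s` and `t` -/

/-- A choice of coordinates `origin + i * t + j * s + s * t * l` on the integers. -/
structure Grid (s t : ℕ) where
  /-- the position with coordinates zero -/
  origin : ℤ
  s_pos : 0 < s
  t_pos : 0 < t
  coprime : Nat.Coprime s t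

namespace Grid

variable {s t : ℕ} (G : Grid s t)

/-- The position with given coordinates. -/
def pos (i : Fin s) (j : Fin t) (l : ℤ) : ℤ := G.origin + (i : ℤ) * t + (j : ℤ) * s + s * t * l

theorem eq_of_dvd {s t : ℕ} (hst : Nat.Coprime s t) {i i' : Fin s}
    (h : (s : ℤ) ∣ ((i : ℤ) - i') * t) : i = i' := by
  have h1 : (s : ℤ) ∣ (i : ℤ) - i' :=
    IsCoprime.dvd_of_dvd_mul_right (Nat.isCoprime_iff_coprime.mpr hst) h
  have h2 := Int.eq_zero_of_abs_lt_dvd h1 (by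
    have := i.2
    have := i'.2
    rw [abs_lt]
    omega)
  exact Fin.ext (by omega)

/-- This is the Chinese remainder theorem. For surjectivity, a Bézout relation gives the row and
column as remainders, and the two quotients add up to the level. -/
theorem pos_bijective : Function.Bijective fun p : (Fin s × Fin t) × ℤ => G.pos p.1.1 p.1.2 p.2 := by
  have hs : (0 : ℤ) < s := by exact_mod_cast G.s_pos
  have ht : (0 : ℤ) < t := by exact_mod_cast G.t_pos
  constructor
  · rintro ⟨⟨i, j⟩, l⟩ ⟨⟨i', j'⟩, l'⟩ h
    simp only [pos] at h
    have h1 : i = i' := eq_of_dvd G.coprime ⟨(j' - j) + t * (l' - l), by linarith⟩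
    have h2 : j = j' := eq_of_dvd G.coprime.symm ⟨(i' - i) + s * (l' - l), by linarith⟩
    subst h1 h2
    have h3 : (s : ℤ) * t * l = s * t * l' := by linarith
    rw [mul_right_inj' (by positivity)] at h3
    rw [h3]
  · intro x
    obtain ⟨a, b, hab⟩ := Nat.isCoprime_iff_coprime.mpr G.coprime
    set y := x - G.origin with hy
    have e1 := Int.emod_add_mul_ediv (y * b) s
    have e2 := Int.emod_add_mul_ediv (y * a) t
    have i1 := Int.emod_nonneg (y * b) hs.ne'
    have i2 := Int.emod_lt_of_pos (y * b) hs
    have j1 := Int.emod_nonneg (y * a) ht.ne'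
    have j2 := Int.emod_lt_of_pos (y * a) ht
    refine ⟨((⟨(y * b % s).toNat, by omega⟩, ⟨(y * a % t).toNat, by omega⟩),
      y * b / s + y * a / t), ?_⟩
    simp only [pos, Int.toNat_of_nonneg i1, Int.toNat_of_nonneg j1]
    have e3 : x = G.origin + y * (a * s + b * t) := by rw [hab]; ring
    rw [e3]
    linear_combination (t : ℤ) * e1 + (s : ℤ) * e2

/-- The positions as an equivalence. -/
noncomputable def equiv : (Fin s × Fin t) × ℤ ≃ ℤ := Equiv.ofBijective _ G.pos_bijective

/-- The row (the residue class modulo `s`) of a position. -/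
noncomputable def row (x : ℤ) : Fin s := (G.equiv.symm x).1.1

/-- The column (the residue class modulo `t`) of a position. -/
noncomputable def col (x : ℤ) : Fin t := (G.equiv.symm x).1.2

/-- The level of a position. -/
noncomputable def lev (x : ℤ) : ℤ := (G.equiv.symm x).2

theorem pos_row_col_lev (x : ℤ) : G.pos (G.row x) (G.col x) (G.lev x) = x :=
  G.equiv.apply_symm_apply x

theorem symm_pos (i : Fin s) (j : Fin t) (l : ℤ) : G.equiv.symm (G.pos i j l) = ((i, j), l) :=
  G.equiv.symm_apply_apply ((i, j), l)

@[simp] theorem row_pos (i : Fin s) (j : Fin t) (l : ℤ) : G.row (G.pos i j l) = i := by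
  rw [row, symm_pos]

@[simp] theorem col_pos (i : Fin s) (j : Fin t) (l : ℤ) : G.col (G.pos i j l) = j := by
  rw [col, symm_pos]

@[simp] theorem lev_pos (i : Fin s) (j : Fin t) (l : ℤ) : G.lev (G.pos i j l) = l := by
  rw [lev, symm_pos]

theorem pos_inj {i i' : Fin s} {j j' : Fin t} {l l' : ℤ} :
    G.pos i j l = G.pos i' j' l' ↔ i = i' ∧ j = j' ∧ l = l' := by
  constructor
  · intro h
    refine ⟨?_, ?_, ?_⟩
    · simpa using congrArg G.row h
    · simpa using congrArg G.col h
    · simpa using congrArg G.lev h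
  · rintro ⟨rfl, rfl, rfl⟩
    rfl

/-- Exchange the roles of `s` and `t`. -/
def swap : Grid t s := ⟨G.origin, G.t_pos, G.s_pos, G.coprime.symm⟩

theorem swap_pos (i : Fin s) (j : Fin t) (l : ℤ) : G.swap.pos j i l = G.pos i j l := by
  simp only [pos, swap]
  ring

theorem swap_row (x : ℤ) : G.swap.row x = G.col x := by
  conv_lhs => rw [← G.pos_row_col_lev x, ← swap_pos, row_pos]

theorem swap_col (x : ℤ) : G.swap.col x = G.row x := by
  conv_lhs => rw [← G.pos_row_col_lev x, ← swap_pos, col_pos]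

theorem swap_lev (x : ℤ) : G.swap.lev x = G.lev x := by
  conv_lhs => rw [← G.pos_row_col_lev x, ← swap_pos, lev_pos]

theorem modEq_row (x : ℤ) : x ≡ G.origin + (G.row x : ℤ) * t [ZMOD s] := by
  conv_lhs => rw [← G.pos_row_col_lev x]
  rw [Int.modEq_iff_dvd, pos]
  exact ⟨-((G.col x : ℤ) + t * G.lev x), by ring⟩

theorem row_eq_of_modEq {x y : ℤ} (h : x ≡ y [ZMOD s]) : G.row x = G.row y := by
  have := ((G.modEq_row x).symm.trans h).trans (G.modEq_row y)
  refine (eq_of_dvd G.coprime ?_).symm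
  have := this.dvd
  rwa [add_sub_add_left_eq_sub, ← sub_mul] at this

theorem sameCharge_iff {f g : ℤ →₀ ℤ} : SameCharge s f g ↔
    ∀ W : Fin s → ℤ, pairing (fun x => W (G.row x)) f = pairing (fun x => W (G.row x)) g := by
  constructor
  · intro h W
    exact h _ fun x y hxy => by rw [G.row_eq_of_modEq hxy]
  · intro h w hw
    have : w = fun x => w (G.origin + (G.row x : ℤ) * t) := funext fun x => hw _ _ (G.modEq_row x)
    rw [this]
    exact h fun i => w (G.origin + (i : ℤ) * t)

theorem sameCharge_iff_indicator {f g : ℤ →₀ ℤ} : SameCharge s f g ↔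
    ∀ i : Fin s, pairing (fun x => if G.row x = i then 1 else 0) f =
      pairing (fun x => if G.row x = i then 1 else 0) g := by
  rw [G.sameCharge_iff]
  constructor
  · intro h i
    exact h fun i' => if i' = i then 1 else 0
  · intro h W
    have : (fun x => W (G.row x)) = fun x => ∑ i, W i * if G.row x = i then 1 else 0 := by
      funext x
      simp
    rw [this, pairing_sum_weight, pairing_sum_weight]
    exact Finset.sum_congr rfl fun i _ => by rw [pairing_mul_weight, pairing_mul_weight, h]

/-! ### Configurations filled up to prescribed levels, and their moments -/

theorem finite_support_fn (b : Fin s → Fin t → ℤ) :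
    (Function.support fun x : ℤ => (if G.lev x < b (G.row x) (G.col x) then (1 : ℤ) else 0) -
      if x < 0 then 1 else 0).Finite := by
  have hs : (0 : ℤ) < s := by exact_mod_cast G.s_pos
  have ht : (0 : ℤ) < t := by exact_mod_cast G.t_pos
  have hst : (1 : ℤ) ≤ s * t := by nlinarith
  refine Set.Finite.subset (s := ⋃ i, ⋃ j, (G.pos i j) ''
    Set.Icc (-(|G.pos i j 0| + |b i j|)) (|G.pos i j 0| + |b i j|))
    (Set.finite_iUnion fun i => Set.finite_iUnion fun j => (Set.finite_Icc _ _).image _) ?_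
  intro x hx
  simp only [Set.mem_iUnion]
  refine ⟨G.row x, G.col x, G.lev x, ?_, G.pos_row_col_lev x⟩
  rw [Function.mem_support] at hx
  have e : x = G.pos (G.row x) (G.col x) 0 + s * t * G.lev x := by
    conv_lhs => rw [← G.pos_row_col_lev x]
    simp only [pos]
    ring
  have h1 := abs_nonneg (b (G.row x) (G.col x))
  have h2 := le_abs_self (b (G.row x) (G.col x))
  have h3 := neg_abs_le (b (G.row x) (G.col x))
  have h4 := abs_nonneg (G.pos (G.row x) (G.col x) 0)
  have h5 := le_abs_self (G.pos (G.row x) (G.col x) 0)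
  have h6 := neg_abs_le (G.pos (G.row x) (G.col x) 0)
  constructor
  · by_contra! hlt
    rw [if_pos (by omega), if_pos (by nlinarith)] at hx
    exact hx rfl
  · by_contra! hlt
    rw [if_neg (by omega), if_neg (by nlinarith)] at hx
    exact hx rfl

/-- The charge function of the bead configuration whose beads are the positions of row `i`,
column `j` and level less than `b i j`. -/
noncomputable def fn (b : Fin s → Fin t → ℤ) : ℤ →₀ ℤ :=
  Finsupp.ofSupportFinite _ (G.finite_support_fn b)

theorem occ_fn (b : Fin s → Fin t → ℤ) (x : ℤ) :
    occ (G.fn b) x = if G.lev x < b (G.row x) (G.col x) then 1 else 0 := by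
  rw [occ, fn, Finsupp.ofSupportFinite_coe]
  ring

theorem occ_fn_pos (b : Fin s → Fin t → ℤ) (i : Fin s) (j : Fin t) (l : ℤ) :
    occ (G.fn b) (G.pos i j l) = if l < b i j then 1 else 0 := by
  rw [occ_fn, lev_pos, row_pos, col_pos]

theorem isMaya_fn (b : Fin s → Fin t → ℤ) : IsMaya (G.fn b) := by
  intro x
  rw [occ_fn]
  split_ifs <;> simp

theorem swap_fn (b : Fin s → Fin t → ℤ) : G.swap.fn (fun j i => b i j) = G.fn b :=
  ext_of_occ fun x => by rw [occ_fn, occ_fn, swap_row, swap_col, swap_lev]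

theorem fn_injective : Function.Injective G.fn := by
  intro b b' h
  funext i j
  have h1 := G.occ_fn_pos b i j (b i j)
  have h2 := G.occ_fn_pos b i j (b' i j)
  have h3 := G.occ_fn_pos b' i j (b i j)
  have h4 := G.occ_fn_pos b' i j (b' i j)
  rw [h] at h1 h2
  split_ifs at h1 h2 h3 h4 <;> omega

theorem fn_add_single (b : Fin s → Fin t → ℤ) (i : Fin s) (j : Fin t) :
    G.fn (fun i' j' => b i' j' + if i' = i ∧ j' = j then 1 else 0) =
      G.fn b + Finsupp.single (G.pos i j (b i j)) 1 := by
  ext x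
  obtain ⟨i', j', l, rfl⟩ : ∃ i' j' l, G.pos i' j' l = x := ⟨_, _, _, G.pos_row_col_lev x⟩
  rw [Finsupp.add_apply, Finsupp.single_apply, ← sub_eq_iff_eq_add', ← occ_sub_occ,
    occ_fn_pos, occ_fn_pos]
  simp only [pos_inj]
  by_cases hi : i' = i
  · by_cases hj : j' = j
    · subst hi hj
      simp only [true_and, and_self, if_true]
      split_ifs <;> omega
    · simp [hj, Ne.symm hj]
  · simp [hi, Ne.symm hi]

theorem _root_.eq_zero_of_single_invariant {ι : Type*} [Fintype ι] [DecidableEq ι]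
    {H : (ι → ℤ) → ℤ} (h : ∀ b p, H (b + Pi.single p 1) = H b) (b : ι → ℤ) : H b = H 0 := by
  have h1 : ∀ (p : ι) (n : ℤ) (b : ι → ℤ), H (b + Pi.single p n) = H b := by
    intro p n
    induction n using Int.induction_on with
    | zero => simp
    | succ n ih =>
      intro b
      rw [Pi.single_add, ← add_assoc, h, ih]
    | pred n ih =>
      intro b
      rw [← h, add_assoc, ← Pi.single_add, sub_add_cancel, ih]
  have h2 : ∀ S : Finset ι, H (∑ p ∈ S, Pi.single p (b p)) = H 0 := by
    classical
    intro S
    induction S using Finset.induction_on with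
    | empty => simp
    | insert p S hp ih => rw [Finset.sum_insert hp, add_comm, h1, ih]
  rw [← h2 Finset.univ, Finset.univ_sum_single]

/-- Raising `b i j` by one adds the bead at `G.pos i j (b i j)`, so a discrete antiderivative `P` of
the weight measures the change. The difference of the two sides is invariant under unit steps, hence
constant. -/
theorem pairing_fn {w : ℤ → ℤ} {P : Fin s → Fin t → ℤ → ℤ}
    (hP : ∀ i j k, P i j (k + 1) - P i j k = w (G.pos i j k)) (b : Fin s → Fin t → ℤ) :
    pairing w (G.fn b) =
      pairing w (G.fn fun _ _ => 0) + ∑ i, ∑ j, (P i j (b i j) - P i j 0) := by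
  have key := eq_zero_of_single_invariant (ι := Fin s × Fin t)
    (H := fun c => pairing w (G.fn fun i j => c (i, j)) - ∑ p : Fin s × Fin t, P p.1 p.2 (c p))
    (by
      rintro (c : Fin s × Fin t → ℤ) ⟨i, j⟩
      have e1 : (fun i' j' => c (i', j') + (Pi.single (i, j) 1 : Fin s × Fin t → ℤ) (i', j')) =
          fun i' j' => c (i', j') + if i' = i ∧ j' = j then 1 else 0 := by
        funext i' j'
        simp [Pi.single_apply]
      have e2 : ∑ p : Fin s × Fin t, P p.1 p.2 (c p + (Pi.single (i, j) 1 : Fin s × Fin t → ℤ) p) =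
          ∑ p : Fin s × Fin t, P p.1 p.2 (c p) + w (G.pos i j (c (i, j))) := by
        rw [← sub_eq_iff_eq_add', ← Finset.sum_sub_distrib, Finset.sum_eq_single (i, j)]
        · simp [hP]
        · intro p _ hp
          simp [hp]
        · simp
      simp only [Pi.add_apply]
      rw [e1, e2, G.fn_add_single fun i j => c (i, j), map_add, pairing_single]
      ring) (fun p => b p.1 p.2)
  simp only [Pi.zero_apply] at key
  rw [Fintype.sum_prod_type, Fintype.sum_prod_type] at key
  simp only [Finset.sum_sub_distrib]
  linarith

theorem pairing_row_fn (W : Fin s → ℤ) (b : Fin s → Fin t → ℤ) :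
    pairing (fun x => W (G.row x)) (G.fn b) =
      pairing (fun x => W (G.row x)) (G.fn fun _ _ => 0) + ∑ i, (∑ j, b i j) * W i := by
  rw [G.pairing_fn (P := fun i _ k => k * W i) (by intro i j k; simp; ring)]
  simp [Finset.sum_mul]

theorem two_mul_pairing_id_fn (b : Fin s → Fin t → ℤ) :
    2 * pairing (fun x => x) (G.fn b) = 2 * pairing (fun x => x) (G.fn fun _ _ => 0) +
      ∑ i, ∑ j, (2 * b i j * (G.origin + (i : ℤ) * t + (j : ℤ) * s) +
        s * t * (b i j * (b i j - 1))) := by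
  rw [← pairing_mul_weight, ← pairing_mul_weight,
    G.pairing_fn (P := fun i j k => 2 * k * (G.origin + (i : ℤ) * t + (j : ℤ) * s) +
        s * t * (k * (k - 1))) (by intro i j k; simp only [pos]; ring)]
  simp

theorem sameCharge_fn_iff {b b' : Fin s → Fin t → ℤ} :
    SameCharge s (G.fn b) (G.fn b') ↔ ∀ i, ∑ j, b i j = ∑ j, b' i j := by
  rw [G.sameCharge_iff]
  constructor
  · intro h i
    have := h fun i' => if i' = i then 1 else 0
    rw [G.pairing_row_fn (fun i' => if i' = i then 1 else 0) b,
      G.pairing_row_fn (fun i' => if i' = i then 1 else 0) b'] at this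
    simpa using this
  · intro h W
    rw [pairing_row_fn, G.pairing_row_fn _ b']
    simp only [h]

theorem sameCharge_fn_iff' {b b' : Fin s → Fin t → ℤ} :
    SameCharge t (G.fn b) (G.fn b') ↔ ∀ j, ∑ i, b i j = ∑ i, b' i j := by
  rw [← G.swap_fn b, ← G.swap_fn b', sameCharge_fn_iff]

/-- Subtracting `s` goes one column to the left, and from column 0 to column `t - 1` one level
lower. Row `i` is filled in exactly this order. -/
theorem isFlush_fn (u c : Fin s → ℤ) :
    IsFlush s (G.fn fun i j => u i + if (j : ℤ) < c i then 1 else 0) := by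
  intro x hx
  have ht := G.t_pos
  obtain ⟨i, j, l, rfl⟩ : ∃ i j l, G.pos i j l = x := ⟨_, _, _, G.pos_row_col_lev x⟩
  rw [occ_fn_pos] at hx
  rcases Nat.eq_zero_or_pos (j : ℕ) with h0 | h0
  · have e : G.pos i j l - s = G.pos i ⟨t - 1, by omega⟩ (l - 1) := by
      simp only [pos, h0]
      push_cast [Nat.cast_sub (show 1 ≤ t by omega)]
      ring
    rw [e, occ_fn_pos, if_pos]
    split_ifs at hx ⊢ <;> omega
  · have e : G.pos i j l - s = G.pos i ⟨j - 1, by omega⟩ l := by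
      simp only [pos]
      push_cast [Nat.cast_sub (show 1 ≤ (j : ℕ) by omega)]
      ring
    rw [e, occ_fn_pos, if_pos]
    push_cast [Nat.cast_sub (show 1 ≤ (j : ℕ) by omega)]
    split_ifs at hx ⊢ <;> omega

theorem isFlush_fn' (v d : Fin t → ℤ) :
    IsFlush t (G.fn fun i j => v j + if (i : ℤ) < d j then 1 else 0) := by
  rw [← swap_fn]
  exact G.swap.isFlush_fn v d

/-- Every pair of total charge zero functions is matched by a matrix. -/
theorem exists_fn (f g : ℤ →₀ ℤ) (h : pairing (fun _ => 1) f = pairing (fun _ => 1) g) :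
    ∃ b : Fin s → Fin t → ℤ, SameCharge s (G.fn b) f ∧ SameCharge t (G.fn b) g := by
  set C : Fin s → ℤ := fun i => pairing (fun x => if G.row x = i then 1 else 0) f -
    pairing (fun x => if G.row x = i then 1 else 0) (G.fn fun _ _ => 0) with hC
  set D : Fin t → ℤ := fun j => pairing (fun x => if G.col x = j then 1 else 0) g -
    pairing (fun x => if G.col x = j then 1 else 0) (G.fn fun _ _ => 0) with hD
  have hCD : ∑ i, C i = ∑ j, D j := by
    rw [hC, hD, Finset.sum_sub_distrib, Finset.sum_sub_distrib, ← pairing_sum_weight,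
      ← pairing_sum_weight, ← pairing_sum_weight, ← pairing_sum_weight]
    simpa using h
  let i₀ : Fin s := ⟨0, G.s_pos⟩
  let j₀ : Fin t := ⟨0, G.t_pos⟩
  -- Row sums go into column `j₀` and column sums into row `i₀`; the corner, which would be counted
  -- twice, is corrected by the common total.
  let b : Fin s → Fin t → ℤ := fun i j => (if j = j₀ then C i else 0) +
    (if i = i₀ then D j else 0) - if i = i₀ then if j = j₀ then ∑ i, C i else 0 else 0
  have hrow : ∀ i, ∑ j, b i j = C i := by
    intro i
    simp only [b, Finset.sum_sub_distrib, Finset.sum_add_distrib]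
    by_cases hi : i = i₀ <;> simp [hi, hCD]
  have hcol : ∀ j, ∑ i, b i j = D j := by
    intro j
    simp only [b, Finset.sum_sub_distrib, Finset.sum_add_distrib]
    by_cases hj : j = j₀ <;> simp [hj]
  refine ⟨b, ?_, ?_⟩
  · rw [G.sameCharge_iff_indicator]
    intro i
    rw [G.pairing_row_fn (fun i' => if i' = i then 1 else 0)]
    simp only [hrow, hC, mul_ite, mul_one, mul_zero, Finset.sum_ite_eq', Finset.mem_univ, if_true]
    ring
  · rw [G.swap.sameCharge_iff_indicator]
    intro j
    rw [← swap_fn, G.swap.pairing_row_fn (fun j' => if j' = j then 1 else 0), G.swap_fn fun _ _ => 0]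
    simp only [hcol, hD, mul_ite, mul_one, mul_zero, Finset.sum_ite_eq', Finset.mem_univ, if_true,
      swap_row]
    ring

/-- Moving the origin turns the sum of the row potentials into zero. -/
theorem exists_shift_row (u : Fin s → ℤ) (v : Fin t → ℤ) {M : Fin s → Fin t → ℤ}
    (hM : IsZeroOne M) : ∃ (G' : Grid s t) (u' : Fin s → ℤ) (M' : Fin s → Fin t → ℤ),
      IsZeroOne M' ∧ ∑ i, u' i = 0 ∧
      G'.fn (fun i j => M' i j + (u' i + v j)) = G.fn fun i j => M i j + (u i + v j) := by
  have hs : (0 : ℤ) < s := by exact_mod_cast G.s_pos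
  set U := ∑ i, u i with hU
  have hnn : ∀ k : Fin s, 0 ≤ ((k : ℤ) + U) % s := fun k => Int.emod_nonneg _ hs.ne'
  -- Moving the origin by `t * U` rotates the rows by `U`; a row that wraps around changes its level
  -- by the quotient.
  let τ : Fin s → Fin s := fun k => ⟨(((k : ℤ) + U) % s).toNat, by
    have h1 := hnn k
    have h2 := Int.emod_lt_of_pos ((k : ℤ) + U) hs
    omega⟩
  have hτ : ∀ k, ((τ k : ℕ) : ℤ) = (k : ℤ) + U - s * (((k : ℤ) + U) / s) := by
    intro k
    simp only [τ, Int.toNat_of_nonneg (hnn k)]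
    have := Int.emod_add_mul_ediv ((k : ℤ) + U) s
    linarith
  have hbij : Function.Bijective τ := by
    refine Finite.injective_iff_bijective.mp fun k k' h => ?_
    have h1 : ((τ k : ℕ) : ℤ) = (τ k' : ℕ) := by rw [h]
    rw [hτ, hτ] at h1
    have h2 := Int.eq_zero_of_abs_lt_dvd (m := (s : ℤ)) (x := (k : ℤ) - k')
      ⟨((k : ℤ) + U) / s - ((k' : ℤ) + U) / s, by linarith⟩ (by
        have := k.2
        have := k'.2
        rw [abs_lt]
        omega)
    exact Fin.ext (by omega)
  refine ⟨⟨G.origin + t * U, G.s_pos, G.t_pos, G.coprime⟩,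
    fun k => u (τ k) - ((k : ℤ) + U) / s, fun k j => M (τ k) j, fun k j => hM _ _, ?_, ?_⟩
  · rw [Finset.sum_sub_distrib, hbij.sum_comp u, ← hU, sub_eq_zero]
    -- The remainders permute the row indices, so comparing both sums shows that the quotients add
    -- up to `U`, the total to be removed.
    have h1 := hbij.sum_comp fun k : Fin s => ((k : ℕ) : ℤ)
    simp only [hτ, Finset.sum_sub_distrib, Finset.sum_add_distrib, ← Finset.mul_sum] at h1
    simp only [Finset.sum_const, Finset.card_univ, Fintype.card_fin, nsmul_eq_mul] at h1
    exact mul_left_cancel₀ hs.ne' (by linarith)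
  · refine ext_of_occ fun x => ?_
    set G' : Grid s t := ⟨G.origin + t * U, G.s_pos, G.t_pos, G.coprime⟩ with hG'
    obtain ⟨k, j, l, rfl⟩ : ∃ k j l, G'.pos k j l = x := ⟨_, _, _, G'.pos_row_col_lev x⟩
    have e : G'.pos k j l = G.pos (τ k) j (l + ((k : ℤ) + U) / s) := by
      simp only [pos, hτ, hG']
      ring
    rw [occ_fn_pos, e, occ_fn_pos]
    simp only
    split_ifs <;> omega

theorem exists_balanced (u : Fin s → ℤ) (v : Fin t → ℤ) {M : Fin s → Fin t → ℤ}
    (hM : IsZeroOne M) : ∃ (G' : Grid s t) (u' : Fin s → ℤ) (v' : Fin t → ℤ)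
      (M' : Fin s → Fin t → ℤ), IsZeroOne M' ∧ ∑ i, u' i = 0 ∧ ∑ j, v' j = 0 ∧
      G'.fn (fun i j => M' i j + (u' i + v' j)) = G.fn fun i j => M i j + (u i + v j) := by
  obtain ⟨G₁, u₁, M₁, hM₁, hu, h₁⟩ := G.exists_shift_row u v hM
  obtain ⟨G₂, v₂, M₂, hM₂, hv, h₂⟩ := G₁.swap.exists_shift_row v u₁ (M := fun j i => M₁ i j)
    fun j i => hM₁ i j
  refine ⟨G₂.swap, u₁, v₂, fun i j => M₂ j i, fun i j => hM₂ j i, hu, hv, ?_⟩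
  rw [← h₁, ← G₁.swap_fn, ← G₂.swap_fn] at *
  simp only [add_comm (v₂ _), add_comm (v _)] at h₂
  exact h₂

end Grid

/-! ### Windows: the partitions of minimal size with given cores -/

theorem sum_fin_lt {n : ℕ} {c : ℤ} (h0 : 0 ≤ c) (hn : c ≤ n) :
    ∑ j : Fin n, (if (j : ℤ) < c then (1 : ℤ) else 0) = c := by
  lift c to ℕ using h0
  rw [Fin.sum_univ_eq_sum_range fun j : ℕ => if (j : ℤ) < c then (1 : ℤ) else 0,
    ← Finset.sum_filter]
  have : (Finset.range n).filter (fun j : ℕ => (j : ℤ) < c) = Finset.range c := by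
    ext j
    simp only [Finset.mem_filter, Finset.mem_range]
    omega
  rw [this]
  simp

theorem sum_fin_lt_mul {n : ℕ} {c : ℤ} (h0 : 0 ≤ c) (hn : c ≤ n) :
    2 * ∑ j : Fin n, (if (j : ℤ) < c then (1 : ℤ) else 0) * j = c * (c - 1) := by
  lift c to ℕ using h0
  rw [Fin.sum_univ_eq_sum_range fun j : ℕ => (if (j : ℤ) < c then (1 : ℤ) else 0) * (j : ℤ)]
  simp only [ite_mul, one_mul, zero_mul]
  rw [← Finset.sum_filter]
  have : (Finset.range n).filter (fun j : ℕ => (j : ℤ) < c) = Finset.range c := by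
    ext j
    simp only [Finset.mem_filter, Finset.mem_range]
    omega
  rw [this]
  clear this hn
  induction c with
  | zero => simp
  | succ c ih =>
    rw [Finset.sum_range_succ, mul_add, ih]
    push_cast
    ring

theorem sum_zero_one_mem {ι : Type*} [Fintype ι] {f : ι → ℤ} (hf : ∀ i, f i = 0 ∨ f i = 1) :
    0 ≤ ∑ i, f i ∧ ∑ i, f i ≤ Fintype.card ι := by
  constructor
  · exact Finset.sum_nonneg fun i _ => by rcases hf i with h | h <;> omega
  · have := Finset.sum_le_card_nsmul Finset.univ f 1 fun i _ => by rcases hf i with h | h <;> omega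
    simpa using this

theorem ite_zero_one (p : Prop) [Decidable p] :
    (if p then (1 : ℤ) else 0) = 0 ∨ (if p then (1 : ℤ) else 0) = 1 := by
  split_ifs <;> simp

/-- The number of rows of `M` whose sum exceeds `a`. -/
def countRows {ι κ : Type*} [Fintype ι] [Fintype κ] (M : ι → κ → ℤ) (a : ℤ) : ℤ :=
  ∑ i, if a < ∑ j, M i j then 1 else 0

/-- The number of columns of `M` whose sum exceeds `a`. -/
def countCols {ι κ : Type*} [Fintype ι] [Fintype κ] (M : ι → κ → ℤ) (a : ℤ) : ℤ :=
  ∑ j, if a < ∑ i, M i j then 1 else 0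

section Fin

variable {s t : ℕ} {M : Fin s → Fin t → ℤ}

theorem countRows_mem (M : Fin s → Fin t → ℤ) (a : ℤ) :
    0 ≤ countRows M a ∧ countRows M a ≤ s := by
  have := sum_zero_one_mem fun i : Fin s => ite_zero_one (a < ∑ j, M i j)
  rwa [Fintype.card_fin] at this

theorem countCols_mem (M : Fin s → Fin t → ℤ) (a : ℤ) :
    0 ≤ countCols M a ∧ countCols M a ≤ t := by
  have := sum_zero_one_mem fun j : Fin t => ite_zero_one (a < ∑ i, M i j)
  rwa [Fintype.card_fin] at this

theorem IsZeroOne.row_mem (hM : IsZeroOne M) (i : Fin s) : 0 ≤ ∑ j, M i j ∧ ∑ j, M i j ≤ t := by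
  simpa using sum_zero_one_mem (hM i)

theorem IsZeroOne.col_mem (hM : IsZeroOne M) (j : Fin t) : 0 ≤ ∑ i, M i j ∧ ∑ i, M i j ≤ s := by
  simpa using sum_zero_one_mem fun i => hM i j

theorem IsZeroOne.sum_countCols (hM : IsZeroOne M) :
    ∑ i : Fin s, countCols M i = ∑ i, ∑ j, M i j := by
  simp only [countCols]
  rw [Finset.sum_comm, Finset.sum_comm (f := M)]
  exact Finset.sum_congr rfl fun j _ => sum_fin_lt (hM.col_mem j).1 (hM.col_mem j).2

/-- The squared count for `i` is the number of ordered pairs of columns whose sums both exceed `i`;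
summing over `i` gives the smaller of the two sums for each pair. -/
theorem IsZeroOne.sum_countCols_sq (hM : IsZeroOne M) :
    ∑ i : Fin s, countCols M i ^ 2 = ∑ j, ∑ l, min (∑ i, M i j) (∑ i, M i l) := by
  simp only [countCols, sq, Finset.sum_mul_sum]
  rw [Finset.sum_comm]
  refine Finset.sum_congr rfl fun j _ => ?_
  rw [Finset.sum_comm]
  refine Finset.sum_congr rfl fun l _ => ?_
  have h1 := hM.col_mem j
  have h2 := hM.col_mem l
  refine Eq.trans (Finset.sum_congr rfl fun i _ => ?_)
    (sum_fin_lt (n := s) (le_min h1.1 h2.1) ((min_le_left _ _).trans h1.2))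
  simp only [lt_min_iff]
  split_ifs <;> simp_all

/-- The margin gap as a difference of first moments. -/
theorem IsZeroOne.marginGap_eq_moment (hM : IsZeroOne M) :
    marginGap M = 2 * (∑ i : Fin s, ∑ j : Fin t, (if (j : ℤ) < countCols M i then (1 : ℤ) else 0) * j -
      ∑ i : Fin s, ∑ j : Fin t, (if (j : ℤ) < ∑ l, M i l then (1 : ℤ) else 0) * j) := by
  rw [mul_sub, Finset.mul_sum, Finset.mul_sum]
  simp only [sum_fin_lt_mul (countCols_mem M _).1 (countCols_mem M _).2,
    sum_fin_lt_mul (hM.row_mem _).1 (hM.row_mem _).2]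
  rw [marginGap, ← hM.sum_countCols_sq]
  have h1 := hM.sum_countCols
  simp only [mul_sub, Finset.sum_sub_distrib, mul_one, sq]
  linarith

end Fin

/-- A normal form for the partitions of minimal size with `s`-core `sig` and `t`-core `tau`: their
beads are the positions of level less than `M i j + u i + v j`. -/
structure CoreWindow (s t : ℕ) (sig tau : YoungDiagram) where
  /-- the coordinates -/
  grid : Grid s t
  /-- the row potentials -/
  u : Fin s → ℤ
  /-- the column potentials -/
  v : Fin t → ℤ
  /-- the matrix of zeros and ones -/
  M : Fin s → Fin t → ℤ
  isZeroOne : IsZeroOne M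
  sum_u : ∑ i, u i = 0
  sum_v : ∑ j, v j = 0
  flush_sig : IsFlush s sig.maya
  flush_tau : IsFlush t tau.maya
  charge_sig : SameCharge s (grid.fn fun i j => M i j + (u i + v j)) sig.maya
  charge_tau : SameCharge t (grid.fn fun i j => M i j + (u i + v j)) tau.maya

theorem nonempty_coreWindow {s t : ℕ} (hs : 0 < s) (ht : 0 < t) (hst : Nat.Coprime s t)
    {sig tau : YoungDiagram} (hsig : IsCorePartition s sig) (htau : IsCorePartition t tau) :
    Nonempty (CoreWindow s t sig tau) := by
  let G₀ : Grid s t := ⟨0, hs, ht, hst⟩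
  obtain ⟨b, hb1, hb2⟩ := G₀.exists_fn sig.maya tau.maya
    (by rw [YoungDiagram.pairing_one_maya, YoungDiagram.pairing_one_maya])
  obtain ⟨u, v, M, hM, h1, h2⟩ := exists_zero_one_add_potential b
  obtain ⟨G, u', v', M', hM', hu, hv, h⟩ := G₀.exists_balanced u v hM
  refine ⟨⟨G, u', v', M', hM', hu, hv, hsig.isFlush hs, htau.isFlush ht, ?_, ?_⟩⟩
  · rw [h]
    exact (G₀.sameCharge_fn_iff.mpr h1).trans hb1
  · rw [h]
    exact (G₀.sameCharge_fn_iff'.mpr h2).trans hb2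

/-! ### Cores in window coordinates, the size formula and the minimal size -/

namespace CoreWindow

variable {s t : ℕ} {sig tau : YoungDiagram} (D : CoreWindow s t sig tau)

/-- The charge function of the bead configuration with matrix `N` in the window. -/
noncomputable def fn (N : Fin s → Fin t → ℤ) : ℤ →₀ ℤ :=
  D.grid.fn fun i j => N i j + (D.u i + D.v j)

/-- Exchange the roles of `s` and `t`. -/
def swap : CoreWindow t s tau sig where
  grid := D.grid.swap
  u := D.v
  v := D.u
  M := fun j i => D.M i j
  isZeroOne := fun j i => D.isZeroOne i j
  sum_u := D.sum_v
  sum_v := D.sum_u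
  flush_sig := D.flush_tau
  flush_tau := D.flush_sig
  charge_sig := by
    have := D.charge_tau
    rw [← Grid.swap_fn] at this
    simpa only [add_comm (D.v _)] using this
  charge_tau := by
    have := D.charge_sig
    rw [← Grid.swap_fn] at this
    simpa only [add_comm (D.v _)] using this

theorem swap_fn (N : Fin s → Fin t → ℤ) : D.swap.fn (fun j i => N i j) = D.fn N := by
  rw [fn, fn, ← D.grid.swap_fn]
  simp only [swap, add_comm (D.v _)]

/-- Since the column potentials sum to zero, row `i` has total `t * u i` plus its row sum in `M`.
The flush filling with this total has `u i` full levels and then its leftmost columns. -/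
theorem maya_sig : sig.maya = D.grid.fn fun i j => D.u i + if (j : ℤ) < ∑ l, D.M i l then 1 else 0 := by
  refine eq_of_isFlush sig.isMaya_maya (D.grid.isMaya_fn _) D.flush_sig (D.grid.isFlush_fn _ _)
    (D.charge_sig.symm.trans ?_)
  rw [Grid.sameCharge_fn_iff]
  intro i
  rw [Finset.sum_add_distrib, Finset.sum_add_distrib, Finset.sum_add_distrib, D.sum_v,
    sum_fin_lt (D.isZeroOne.row_mem i).1 (D.isZeroOne.row_mem i).2]
  ring

theorem maya_tau : tau.maya = D.grid.fn fun i j => D.v j + if (i : ℤ) < ∑ r, D.M r j then 1 else 0 := by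
  rw [D.swap.maya_sig, ← Grid.swap_fn]
  rfl

/-- The row potentials also sum to zero, so column `j` of the configuration of `sig` totals the
number of row sums exceeding `j`, and both potentials disappear. -/
theorem maya_corePart_sig : (corePart t sig).maya =
    D.grid.fn fun i j => if (i : ℤ) < countRows D.M j then 1 else 0 := by
  obtain ⟨h1, h2, -⟩ := corePart_spec t sig
  have hfl := D.grid.isFlush_fn' (fun _ => 0) fun j => countRows D.M j
  simp only [zero_add] at hfl
  refine eq_of_isFlush (YoungDiagram.isMaya_maya _) (D.grid.isMaya_fn _)
    (h1.isFlush D.grid.t_pos) hfl (h2.trans ?_)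
  rw [D.maya_sig, Grid.sameCharge_fn_iff']
  intro j
  rw [Finset.sum_add_distrib, D.sum_u, sum_fin_lt (countRows_mem _ _).1 (countRows_mem _ _).2,
    zero_add]
  rfl

theorem maya_corePart_tau : (corePart s tau).maya =
    D.grid.fn fun i j => if (j : ℤ) < countCols D.M i then 1 else 0 := by
  rw [D.swap.maya_corePart_sig, ← Grid.swap_fn]
  rfl

/-- Expressing the gap as a moment of the two cores of cores makes it computable when they differ by
a single bead move. -/
theorem marginGap_eq_pairing_col : marginGap D.M =
    2 * (pairing (fun x => (D.grid.col x : ℤ)) (corePart s tau).maya -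
      pairing (fun x => (D.grid.col x : ℤ)) (corePart t sig).maya) := by
  have key : ∀ b : Fin s → Fin t → ℤ, pairing (fun x => (D.grid.col x : ℤ)) (D.grid.fn b) =
      pairing (fun x => (D.grid.col x : ℤ)) (D.grid.fn fun _ _ => 0) +
        ∑ j : Fin t, (∑ i, b i j) * (j : ℤ) := by
    intro b
    have := D.grid.swap.pairing_row_fn (fun j => (j : ℤ)) fun j i => b i j
    rw [Grid.swap_fn, D.grid.swap_fn fun _ _ => 0] at this
    simpa only [Grid.swap_row] using this
  rw [D.maya_corePart_tau, D.maya_corePart_sig, key, key fun i j =>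
    if (i : ℤ) < countRows D.M j then 1 else 0, D.isZeroOne.marginGap_eq_moment]
  simp only [sum_fin_lt (countRows_mem _ _).1 (countRows_mem _ _).2]
  rw [add_sub_add_left_eq_sub]
  congr 2
  · rw [Finset.sum_comm]
    simp only [Finset.sum_mul]
  · rw [Finset.sum_comm]
    simp only [countRows, Finset.sum_mul]

/-- The size of the minimal partitions in terms of the cores. -/
theorem two_mul_pairing_id_fn_M : 2 * (pairing (fun x => x) (D.fn D.M) + (corePart s tau).card -
    sig.card - tau.card) = s * marginGap D.M := by
  rw [← YoungDiagram.pairing_id_maya, ← YoungDiagram.pairing_id_maya, ← YoungDiagram.pairing_id_maya,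
    D.maya_corePart_tau, D.maya_tau, D.maya_sig, fn, D.isZeroOne.marginGap_eq_moment]
  set A : Fin s → Fin t → ℤ := fun i j => if (j : ℤ) < ∑ l, D.M i l then 1 else 0 with hA
  set B : Fin s → Fin t → ℤ := fun i j => if (i : ℤ) < ∑ r, D.M r j then 1 else 0 with hB
  set K : Fin s → Fin t → ℤ := fun i j => if (j : ℤ) < countCols D.M i then 1 else 0 with hK
  have hA2 : ∀ i j, A i j * A i j = A i j := by
    intro i j
    simp only [hA]
    split_ifs <;> simp
  have hB2 : ∀ i j, B i j * B i j = B i j := by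
    intro i j
    simp only [hB]
    split_ifs <;> simp
  have hK2 : ∀ i j, K i j * K i j = K i j := by
    intro i j
    simp only [hK]
    split_ifs <;> simp
  have hM2 : ∀ i j, D.M i j * D.M i j = D.M i j := by
    intro i j
    rcases D.isZeroOne i j with h | h <;> simp [h]
  have rA : ∀ i, ∑ j, A i j = ∑ j, D.M i j := fun i =>
    sum_fin_lt (D.isZeroOne.row_mem i).1 (D.isZeroOne.row_mem i).2
  have cB : ∀ j, ∑ i, B i j = ∑ i, D.M i j := fun j =>
    sum_fin_lt (D.isZeroOne.col_mem j).1 (D.isZeroOne.col_mem j).2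
  have rK : ∀ i, ∑ j, K i j = ∑ j, B i j := fun i =>
    sum_fin_lt (countCols_mem _ _).1 (countCols_mem _ _).2
  have z1 : ∑ i : Fin s, ∑ j, (D.grid.origin + (i : ℤ) * t) * (D.M i j + K i j - A i j - B i j) = 0 := by
    refine Finset.sum_eq_zero fun i _ => ?_
    rw [← Finset.mul_sum, Finset.sum_sub_distrib, Finset.sum_sub_distrib, Finset.sum_add_distrib,
      rA, rK]
    ring
  have z2 : ∑ i : Fin s, ∑ j : Fin t, ((j : ℤ) * s) * (D.M i j - B i j) = 0 := by
    rw [Finset.sum_comm]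
    refine Finset.sum_eq_zero fun j _ => ?_
    rw [← Finset.mul_sum, Finset.sum_sub_distrib, cB, sub_self, mul_zero]
  have z3 : ∑ i, ∑ j, D.u i * (D.M i j - A i j) = 0 := by
    refine Finset.sum_eq_zero fun i _ => ?_
    rw [← Finset.mul_sum, Finset.sum_sub_distrib, rA, sub_self, mul_zero]
  have z4 : ∑ i, ∑ j, D.v j * (D.M i j - B i j) = 0 := by
    rw [Finset.sum_comm]
    refine Finset.sum_eq_zero fun j _ => ?_
    rw [← Finset.mul_sum, Finset.sum_sub_distrib, cB, sub_self, mul_zero]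
  have z5 : ∑ i, ∑ j, D.u i * D.v j = 0 := by
    rw [← Finset.sum_mul_sum, D.sum_u, zero_mul]
  -- In the quadratic size formula the squares of `M`, `K`, `A`, `B` reduce to themselves. `M` and
  -- `A` share row sums, `M` and `B` column sums, `K` and `B` row sums, so only the column moments
  -- of `K` and `A` survive; their difference gives the margin gap.
  have total : ∀ X Y Z W : Fin s → Fin t → ℤ, (∀ i j, X i j + Y i j - Z i j - W i j =
      2 * ((D.grid.origin + (i : ℤ) * t) * (D.M i j + K i j - A i j - B i j)) +
      2 * (((j : ℤ) * s) * (D.M i j - B i j)) + 2 * s * (K i j * j) - 2 * s * (A i j * j) +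
      2 * s * t * (D.u i * (D.M i j - A i j)) + 2 * s * t * (D.v j * (D.M i j - B i j)) +
      2 * s * t * (D.u i * D.v j)) →
      ∑ i, ∑ j, X i j + ∑ i, ∑ j, Y i j - ∑ i, ∑ j, Z i j - ∑ i, ∑ j, W i j =
        2 * s * (∑ i, ∑ j : Fin t, K i j * j) - 2 * s * (∑ i, ∑ j : Fin t, A i j * j) := by
    intro X Y Z W h
    simp only [← Finset.sum_add_distrib, ← Finset.sum_sub_distrib, h]
    simp only [Finset.sum_add_distrib, Finset.sum_sub_distrib, ← Finset.mul_sum]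
    simp only [← Finset.mul_sum] at z1 z3 z4 z5 z2
    simp only [Finset.sum_add_distrib, Finset.sum_sub_distrib] at z1 z2 z3 z4 z5
    linear_combination 2 * z1 + 2 * z2 + 2 * s * t * (z3 + z4 + z5)
  change 2 * (pairing (fun x => x) (D.grid.fn fun i j => D.M i j + (D.u i + D.v j)) +
      pairing (fun x => x) (D.grid.fn K) - pairing (fun x => x) (D.grid.fn fun i j => D.u i + A i j) -
      pairing (fun x => x) (D.grid.fn fun i j => D.v j + B i j)) =
    s * (2 * (∑ i, ∑ j : Fin t, K i j * j - ∑ i, ∑ j : Fin t, A i j * j))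
  have e1 := D.grid.two_mul_pairing_id_fn fun i j => D.M i j + (D.u i + D.v j)
  have e2 := D.grid.two_mul_pairing_id_fn K
  have e3 := D.grid.two_mul_pairing_id_fn fun i j => D.u i + A i j
  have e4 := D.grid.two_mul_pairing_id_fn fun i j => D.v j + B i j
  let Q : (Fin s → Fin t → ℤ) → Fin s → Fin t → ℤ := fun b i j =>
    2 * b i j * (D.grid.origin + (i : ℤ) * t + (j : ℤ) * s) + s * t * (b i j * (b i j - 1))
  have fin := total (Q fun i j => D.M i j + (D.u i + D.v j)) (Q K) (Q fun i j => D.u i + A i j)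
    (Q fun i j => D.v j + B i j) fun i j => by
      simp only [Q]
      linear_combination (s * t : ℤ) * (hM2 i j + hK2 i j - hA2 i j - hB2 i j)
  simp only [Q] at fin
  linear_combination e1 + e2 - e3 - e4 + fin

/-- The level of a position relative to the window. -/
noncomputable def level (x : ℤ) : ℤ := D.grid.lev x - (D.u (D.grid.row x) + D.v (D.grid.col x))

/-- The position in row `i` and column `j` of level zero relative to the window. -/
def base (i : Fin s) (j : Fin t) : ℤ := D.grid.pos i j (D.u i + D.v j)

theorem base_inj {i i' : Fin s} {j j' : Fin t} (h : D.base i j = D.base i' j') :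
    i = i' ∧ j = j' :=
  have := D.grid.pos_inj.mp h
  ⟨this.1, this.2.1⟩

theorem base_add_base (i k : Fin s) (j l : Fin t) :
    D.base i j + D.base k l = D.base i l + D.base k j := by
  simp only [base, Grid.pos]
  ring

theorem exists_base_add (x : ℤ) :
    ∃ i j, x = D.base i j + s * t * D.level x ∧ i = D.grid.row x ∧ j = D.grid.col x := by
  refine ⟨_, _, ?_, rfl, rfl⟩
  conv_lhs => rw [← D.grid.pos_row_col_lev x]
  simp only [base, level, Grid.pos]
  ring

theorem base_add (i : Fin s) (j : Fin t) (l : ℤ) :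
    D.base i j + s * t * l = D.grid.pos i j (l + (D.u i + D.v j)) := by
  simp only [base, Grid.pos]
  ring

theorem occ_fn_base_add (N : Fin s → Fin t → ℤ) (i : Fin s) (j : Fin t) (l : ℤ) :
    occ (D.fn N) (D.base i j + s * t * l) = if l < N i j then 1 else 0 := by
  rw [base_add, fn, Grid.occ_fn_pos]
  simp only [add_lt_add_iff_right]

theorem fn_injective : Function.Injective D.fn := by
  intro N N' h
  have := D.grid.fn_injective h
  funext i j
  have := congrFun (congrFun this i) j
  simpa using this

theorem isMaya_fn (N : Fin s → Fin t → ℤ) : IsMaya (D.fn N) := D.grid.isMaya_fn _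

theorem sameMargins_iff {N N' : Fin s → Fin t → ℤ} :
    SameMargins N N' ↔ SameCharge s (D.fn N) (D.fn N') ∧ SameCharge t (D.fn N) (D.fn N') := by
  rw [fn, fn, Grid.sameCharge_fn_iff, Grid.sameCharge_fn_iff']
  simp only [Finset.sum_add_distrib, add_left_inj]
  rfl

/-- A position is a term in its row, plus a term in its column, plus `s * t` times its relative
level; equal charges cancel the first two. -/
theorem pairing_id_sub {f g : ℤ →₀ ℤ} (hs : SameCharge s f g) (ht : SameCharge t f g) :
    pairing (fun x => x) f - pairing (fun x => x) g = s * t * pairing D.level (f - g) := by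
  have hid : (fun x : ℤ => x) = fun x =>
      ((D.grid.origin + (D.grid.row x : ℤ) * t + s * t * D.u (D.grid.row x)) +
        ((D.grid.col x : ℤ) * s + s * t * D.v (D.grid.col x))) + (s * t : ℤ) * D.level x := by
    funext x
    conv_lhs => rw [← D.grid.pos_row_col_lev x]
    simp only [level, Grid.pos]
    ring
  rw [← map_sub]
  conv_lhs => rw [hid]
  rw [pairing_add_weight, pairing_add_weight, pairing_mul_weight, map_sub, map_sub,
    D.grid.sameCharge_iff.mp hs fun i => D.grid.origin + (i : ℤ) * t + s * t * D.u i]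
  have := D.grid.swap.sameCharge_iff.mp ht fun j => (j : ℤ) * s + s * t * D.v j
  simp only [Grid.swap_row] at this
  rw [this]
  ring

/-- A zero-one window has beads at all negative relative levels and none at positive ones. Any
deviation there adds a bead at a positive level or removes one at a negative level. -/
theorem level_mul_nonneg {N : Fin s → Fin t → ℤ} (hN : IsZeroOne N) {f : ℤ →₀ ℤ} (hf : IsMaya f)
    (x : ℤ) : 0 ≤ (f - D.fn N) x * D.level x := by
  obtain ⟨i, j, hx, -, -⟩ := D.exists_base_add x
  have h1 := D.occ_fn_base_add N i j (D.level x)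
  rw [← hx] at h1
  rw [Finsupp.sub_apply, ← occ_sub_occ, h1]
  have h2 := hf x
  have h3 := hN i j
  rcases lt_trichotomy (D.level x) 0 with h | h | h
  · rw [if_pos (by omega)]
    exact mul_nonneg_of_nonpos_of_nonpos (by omega) h.le
  · simp [h]
  · rw [if_neg (by omega)]
    exact mul_nonneg (by omega) h.le

theorem exists_eq_fn {N : Fin s → Fin t → ℤ} (hN : IsZeroOne N) {f : ℤ →₀ ℤ} (hf : IsMaya f)
    (h : pairing D.level (f - D.fn N) = 0) : ∃ N', IsZeroOne N' ∧ f = D.fn N' := by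
  refine ⟨fun i j => occ f (D.base i j), fun i j => hf _, ext_of_occ fun x => ?_⟩
  have h0 := mul_eq_zero_of_pairing_eq_zero (D.level_mul_nonneg hN hf) h x
  obtain ⟨i, j, hx, -, -⟩ := D.exists_base_add x
  have h1 := D.occ_fn_base_add N i j (D.level x)
  have h2 := D.occ_fn_base_add (fun i j => occ f (D.base i j)) i j (D.level x)
  rw [← hx] at h1 h2
  rw [Finsupp.sub_apply, ← occ_sub_occ, h1] at h0
  rw [h2]
  have h3 := hN i j
  have h4 := hf (D.base i j)
  rcases mul_eq_zero.mp h0 with h0 | h0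
  · rcases lt_trichotomy (D.level x) 0 with h | h | h
    · rw [if_pos (by omega)] at h0 ⊢
      omega
    · rw [h, mul_zero, add_zero] at hx
      rw [h, hx]
      split_ifs <;> omega
    · rw [if_neg (by omega)] at h0 ⊢
      omega
  · rw [h0, mul_zero, add_zero] at hx
    rw [h0, hx]
    split_ifs <;> omega

theorem pairing_level_fn {N N' : Fin s → Fin t → ℤ} (hN : IsZeroOne N) (hN' : IsZeroOne N') :
    pairing D.level (D.fn N - D.fn N') = 0 := by
  refine le_antisymm ?_ (pairing_nonneg (D.level_mul_nonneg hN' (D.isMaya_fn N)))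
  have := pairing_nonneg (D.level_mul_nonneg hN (D.isMaya_fn N'))
  rw [map_sub] at this ⊢
  linarith

/-- The size of the partitions described by the window. -/
noncomputable def size : ℤ := pairing (fun x => x) (D.fn D.M)

theorem mem_iff {n : ℕ} {lam : YoungDiagram} : lam ∈ partitionsWithCores s t sig tau n ↔
    lam.card = n ∧ SameCharge s lam.maya (D.fn D.M) ∧ SameCharge t lam.maya (D.fn D.M) := by
  rw [mem_partitionsWithCores_iff D.grid.s_pos D.grid.t_pos D.flush_sig D.flush_tau]
  refine and_congr_right fun _ => and_congr ?_ ?_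
  · exact ⟨fun h => h.trans D.charge_sig.symm, fun h => h.trans D.charge_sig⟩
  · exact ⟨fun h => h.trans D.charge_tau.symm, fun h => h.trans D.charge_tau⟩

theorem total_fn : pairing (fun _ => 1) (D.fn D.M) = 0 := by
  rw [← sig.pairing_one_maya]
  exact D.charge_sig.total

theorem exists_size_add {n : ℕ} {lam : YoungDiagram}
    (h : lam ∈ partitionsWithCores s t sig tau n) :
    ∃ W : ℤ, 0 ≤ W ∧ (n : ℤ) = D.size + s * t * W ∧
      (W = 0 → ∃ N, IsZeroOne N ∧ SameMargins D.M N ∧ lam.maya = D.fn N) := by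
  obtain ⟨hc, h1, h2⟩ := D.mem_iff.mp h
  refine ⟨_, pairing_nonneg (D.level_mul_nonneg D.isZeroOne lam.isMaya_maya), ?_, fun h0 => ?_⟩
  · rw [← D.pairing_id_sub h1 h2, YoungDiagram.pairing_id_maya, hc, size]
    ring
  · obtain ⟨N, hN, hlam⟩ := D.exists_eq_fn D.isZeroOne lam.isMaya_maya h0
    rw [hlam] at h1 h2
    exact ⟨N, hN, D.sameMargins_iff.mpr ⟨h1.symm, h2.symm⟩, hlam⟩

theorem exists_matrix {n : ℕ} (hn : (n : ℤ) = D.size) {lam : YoungDiagram}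
    (h : lam ∈ partitionsWithCores s t sig tau n) :
    ∃ N, IsZeroOne N ∧ SameMargins D.M N ∧ lam.maya = D.fn N := by
  obtain ⟨W, -, h1, h2⟩ := D.exists_size_add h
  have hs : (s : ℤ) ≠ 0 := by exact_mod_cast D.grid.s_pos.ne'
  have ht : (t : ℤ) ≠ 0 := by exact_mod_cast D.grid.t_pos.ne'
  refine h2 ?_
  have h3 : (s : ℤ) * t * W = 0 := by linarith
  exact (mul_eq_zero.mp h3).resolve_left (mul_ne_zero hs ht)

theorem exists_mem_of_matrix {n : ℕ} (hn : (n : ℤ) = D.size) {N : Fin s → Fin t → ℤ}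
    (hN : IsZeroOne N) (hMN : SameMargins D.M N) :
    ∃ lam ∈ partitionsWithCores s t sig tau n, lam.maya = D.fn N := by
  obtain ⟨h1, h2⟩ := D.sameMargins_iff.mp hMN
  obtain ⟨lam, hlam⟩ := YoungDiagram.exists_maya_eq (D.isMaya_fn N) (h1.total ▸ D.total_fn)
  refine ⟨lam, D.mem_iff.mpr ⟨?_, ?_, ?_⟩, hlam⟩
  · have h3 := D.pairing_id_sub h1.symm h2.symm
    rw [D.pairing_level_fn hN D.isZeroOne, ← hlam, YoungDiagram.pairing_id_maya] at h3
    rw [size] at hn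
    have : (lam.card : ℤ) = n := by linarith
    exact_mod_cast this
  · rw [hlam]
    exact h1.symm
  · rw [hlam]
    exact h2.symm

theorem exists_card_eq_size : ∃ n : ℕ, (n : ℤ) = D.size := by
  obtain ⟨lam, hlam⟩ := YoungDiagram.exists_maya_eq (D.isMaya_fn D.M) D.total_fn
  exact ⟨lam.card, by rw [size, ← hlam, YoungDiagram.pairing_id_maya]⟩

theorem minSizeWithCores_eq : (minSizeWithCores s t sig tau : ℤ) = D.size := by
  obtain ⟨n, hn⟩ := D.exists_card_eq_size
  obtain ⟨lam, hlam, -⟩ := D.exists_mem_of_matrix hn D.isZeroOne ⟨fun _ => rfl, fun _ => rfl⟩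
  rw [← hn]
  congr 1
  refine le_antisymm (Nat.sInf_le ⟨lam, hlam⟩) (le_csInf ⟨n, lam, hlam⟩ ?_)
  rintro m ⟨mu, hmu⟩
  obtain ⟨W, hW, h, -⟩ := D.exists_size_add hmu
  have : (0 : ℤ) ≤ s * t * W := by positivity
  omega

/-- In non-minimal size there are at least as many partitions as there are positions in the grid. -/
theorem exists_injective_of_size_lt {n : ℕ} {lam : YoungDiagram}
    (h : lam ∈ partitionsWithCores s t sig tau n) (hn : (n : ℤ) ≠ D.size) :
    ∃ F : Fin s × Fin t → YoungDiagram, Function.Injective F ∧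
      ∀ p, F p ∈ partitionsWithCores s t sig tau n := by
  obtain ⟨W, hW, hnW, -⟩ := D.exists_size_add h
  have hW' : 1 ≤ W := by
    rcases hW.eq_or_lt with h0 | h0
    · rw [← h0, mul_zero, add_zero] at hnW
      exact absurd hnW hn
    · exact h0
  -- In each class modulo `s * t`, the topmost bead is raised by the `W` levels that account for the
  -- excess in size. This preserves both cores.
  let x : Fin s × Fin t → ℤ := fun p => D.base p.1 p.2 + s * t * (D.M p.1 p.2 - 1)
  let y : Fin s × Fin t → ℤ := fun p => D.base p.1 p.2 + s * t * (D.M p.1 p.2 - 1 + W)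
  have hx : ∀ p, occ (D.fn D.M) (x p) = 1 := fun p => by
    simp only [x, occ_fn_base_add]
    rw [if_pos (by omega)]
  have hy : ∀ p, occ (D.fn D.M) (y p) = 0 := fun p => by
    simp only [y, occ_fn_base_add]
    rw [if_neg (by omega)]
  have hex : ∀ p, ∃ mu : YoungDiagram, mu.maya = moveBead (D.fn D.M) (x p) (y p) := fun p =>
    YoungDiagram.exists_maya_eq ((D.isMaya_fn _).moveBead (hx p) (hy p))
      (by rw [pairing_moveBead, D.total_fn]; ring)
  choose F hF using hex
  refine ⟨F, fun p q hpq => ?_, fun p => D.mem_iff.mpr ⟨?_, ?_, ?_⟩⟩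
  · have h1 := hF p
    rw [hpq, hF q] at h1
    have h2 := DFunLike.congr_fun h1 (x p)
    rw [moveBead_apply, moveBead_apply, if_pos rfl, if_neg (c := x p = y p)] at h2
    · have h3 : x p = x q := by
        by_contra hne
        rw [if_neg hne] at h2
        split_ifs at h2 <;> omega
      have h4 := h3
      simp only [x, base_add, Grid.pos_inj] at h4
      exact Prod.ext h4.1 h4.2.1
    · intro hcon
      have e1 := hx p
      have e2 := hy p
      rw [hcon, e2] at e1
      omega
  · have h1 : ((F p).card : ℤ) = n := by
      rw [← YoungDiagram.pairing_id_maya, hF, pairing_moveBead, hnW, size]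
      simp only [x, y]
      ring
    exact_mod_cast h1
  · rw [hF]
    exact sameCharge_moveBead _ (Int.modEq_iff_dvd.mpr ⟨t * W, by simp only [x, y]; ring⟩)
  · rw [hF]
    exact sameCharge_moveBead _ (Int.modEq_iff_dvd.mpr ⟨s * W, by simp only [x, y]; ring⟩)

end CoreWindow

/-! ### Matrices with one interchange and rim hooks between the cores -/

theorem countRows_le_of_not_interchange {ι κ : Type*} [Fintype ι] [Fintype κ] {N : ι → κ → ℤ}
    (hN : IsZeroOne N) (h : ∀ i k j l, ¬ Interchange N i k j l) {a b : ℤ} (ha : 0 ≤ a)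
    (hab : a < countRows N b) : b < countCols N a := by
  classical
  have hne : (Finset.univ.filter fun i => b < ∑ j, N i j).Nonempty := by
    by_contra hcon
    rw [Finset.not_nonempty_iff_eq_empty] at hcon
    rw [countRows, ← Finset.sum_filter, hcon] at hab
    simp only [Finset.sum_empty] at hab
    omega
  -- Columns of `N` are upward closed for the row sums. Choosing the smallest row sum above `b`,
  -- each of the more than `b` columns with a one in row `r` contains every row counted by
  -- `countRows N b`.
  obtain ⟨r, hr, hmin⟩ := Finset.exists_min_image _ (fun i => ∑ j, N i j) hne
  have hr' := (Finset.mem_filter.mp hr).2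
  refine hr'.trans_le (Finset.sum_le_sum fun j _ => ?_)
  rcases hN r j with h0 | h1
  · rw [h0]
    split_ifs <;> simp
  · rw [h1, if_pos]
    refine hab.trans_le (Finset.sum_le_sum fun i _ => ?_)
    split_ifs with hi
    · have hup := upClosed_of_not_interchange (M := fun j i => N i j) (fun j i => hN i j) (i := j)
        fun l i k h' => h i k j l ⟨h'.1, h'.2.1, h'.2.2.2, h'.2.2.1⟩
      have := hup r i h1 (hmin i (Finset.mem_filter.mpr ⟨Finset.mem_univ _, hi⟩))
      simp only at this
      omega
    · rcases hN i j with h2 | h2 <;> omega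

/-- For a matrix without interchanges the row and column sums are conjugate. -/
theorem lt_countCols_iff_of_not_interchange {ι κ : Type*} [Fintype ι] [Fintype κ] {N : ι → κ → ℤ}
    (hN : IsZeroOne N) (h : ∀ i k j l, ¬ Interchange N i k j l) {a b : ℤ} (ha : 0 ≤ a)
    (hb : 0 ≤ b) : b < countCols N a ↔ a < countRows N b :=
  ⟨countRows_le_of_not_interchange (N := fun j i => N i j) (fun j i => hN i j)
    (fun j l i k h' => h i k j l ⟨h'.1, h'.2.1, h'.2.2.2, h'.2.2.1⟩) hb,
    countRows_le_of_not_interchange hN h ha⟩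

theorem OnlyInterchange.sum_row_eq {ι κ : Type*} [Fintype κ] {M : ι → κ → ℤ} (hM : IsZeroOne M)
    {i k : ι} {j l : κ} (h : OnlyInterchange M i k j l) : ∑ b, M i b = ∑ b, M k b :=
  h.swap.sum_col_eq fun b a => hM a b

/-- Making rows `i` and `k`, which have equal sums, unequal by one unit each lowers the gap from 2
to 0 and keeps the column sums. The new row sums are then conjugate to the column sums, and the
correction terms record the two changed rows. -/
theorem OnlyInterchange.lt_countCols_iff {ι κ : Type*} [Fintype ι] [Fintype κ] {M : ι → κ → ℤ}
    (hM : IsZeroOne M) {i k : ι} {j l : κ} (h : OnlyInterchange M i k j l) {a b : ℤ} (ha : 0 ≤ a)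
    (hb : 0 ≤ b) : b < countCols M a ↔ a < countRows M b +
      ((if b = ∑ c, M i c then 1 else 0) - if b = ∑ c, M i c - 1 then 1 else 0) := by
  classical
  have hik := h.1.ne_row
  let δ : ι → ℤ := fun r => (if r = i then 1 else 0) - if r = k then 1 else 0
  let N : ι → κ → ℤ := fun r c => M r c + δ r * if c = l then 1 else 0
  have hδ : ∑ r, δ r = 0 := by simp [δ]
  have hrow : ∀ r, ∑ c, N r c = ∑ c, M r c + δ r := by
    intro r
    simp [N, Finset.sum_add_distrib]
  have hcol : ∀ c, ∑ r, N r c = ∑ r, M r c := by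
    intro c
    simp [N, Finset.sum_add_distrib, hδ]
  have hN : IsZeroOne N := by
    intro r c
    simp only [N, δ]
    have h0 := hM r c
    by_cases hc : c = l
    · subst hc
      by_cases hi : r = i
      · subst hi
        simp [hik, h.1.2.2.1]
      · by_cases hk : r = k
        · subst hk
          simp [hi, h.1.2.1]
        · simpa [hi, hk] using h0
    · simpa [hc] using h0
  have hgap : marginGap N = 0 := by
    have h2 := marginGap_of_onlyInterchange hM h
    rw [marginGap] at h2 ⊢
    simp only [hrow, hcol]
    have h3 : ∑ r, ((∑ c, M r c + δ r) ^ 2 - (∑ c, M r c) ^ 2) = 2 := by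
      rw [Finset.sum_eq_add i k hik]
      · simp only [δ, hik, hik.symm, if_true, if_false, h.sum_row_eq hM]
        ring
      · intro r _ hr
        simp [δ, hr.1, hr.2]
      · simp
      · simp
    rw [Finset.sum_sub_distrib] at h3
    linarith
  have hcc : countCols N a = countCols M a := by simp only [countCols, hcol]
  have hcr : countRows N b = countRows M b +
      ((if b = ∑ c, M i c then 1 else 0) - if b = ∑ c, M i c - 1 then 1 else 0) := by
    rw [countRows, countRows, ← sub_eq_iff_eq_add', ← Finset.sum_sub_distrib,
      Finset.sum_eq_add i k hik]
    · simp only [hrow, δ, hik, hik.symm, if_true, if_false, ← h.sum_row_eq hM]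
      split_ifs <;> omega
    · intro r _ hr
      simp [hrow, δ, hr.1, hr.2]
    · simp
    · simp
  rw [← hcc, ← hcr]
  exact lt_countCols_iff_of_not_interchange hN (not_interchange_of_marginGap_eq_zero hN hgap) ha hb

theorem transpose_mem_partitionsWithCores {s t : ℕ} (hs : 0 < s) (ht : 0 < t)
    {sig tau : YoungDiagram} (hsig : sig.transpose = sig) (htau : tau.transpose = tau) {n : ℕ}
    {lam : YoungDiagram} (h : lam ∈ partitionsWithCores s t sig tau n) :
    lam.transpose ∈ partitionsWithCores s t sig tau n := by
  obtain ⟨h1, h2, h3⟩ := h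
  refine ⟨lam.card_transpose.trans h1, ?_, ?_⟩
  · rw [corePart_transpose hs, h2, hsig]
  · rw [corePart_transpose ht, h3, htau]

/-! ### Interchanges, rim hooks and conjugation in the window -/

namespace CoreWindow

variable {s t : ℕ} {sig tau : YoungDiagram} (D : CoreWindow s t sig tau)

theorem exists_moveBead {i k : Fin s} {j l : Fin t} (h : OnlyInterchange D.M i k j l) :
    ∃ x y, x ≠ y ∧ (corePart s tau).maya = moveBead (corePart t sig).maya x y := by
  set X := ∑ c, D.M i c with hX
  have hs := D.grid.s_pos
  have hle : ∀ c, D.M i c ≤ 1 := fun c => by rcases D.isZeroOne i c with h | h <;> omega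
  have hge : ∀ c, 0 ≤ D.M i c := fun c => by rcases D.isZeroOne i c with h | h <;> omega
  have hX1 : 1 ≤ X := by
    have := Finset.single_le_sum (f := D.M i) (fun c _ => hge c) (Finset.mem_univ j)
    rwa [h.1.1] at this
  have hXt : X < t := by
    have := Finset.sum_lt_sum (f := D.M i) (g := fun _ => 1) (fun c _ => hle c)
      ⟨l, Finset.mem_univ _, by rw [h.1.2.2.1]; norm_num⟩
    simpa using this
  let p : Fin t := ⟨X.toNat, by omega⟩
  let q : Fin t := ⟨(X - 1).toNat, by omega⟩
  have hp : ((p : ℕ) : ℤ) = X := Int.toNat_of_nonneg (by omega)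
  have hq : ((q : ℕ) : ℤ) = X - 1 := Int.toNat_of_nonneg (by omega)
  have hpq : p ≠ q := by
    intro hcon
    rw [hcon, hq] at hp
    omega
  have hP0 := (countRows_mem D.M X).1
  have hPs : countRows D.M X < s := by
    have := Finset.sum_lt_sum (f := fun r : Fin s => if X < ∑ c, D.M r c then (1 : ℤ) else 0)
      (g := fun _ => 1) (fun r _ => by split_ifs <;> simp)
      ⟨i, Finset.mem_univ _, by rw [if_neg (by omega)]; norm_num⟩
    exact lt_of_lt_of_eq this (by simp)
  have hQs := (countRows_mem D.M (X - 1)).2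
  have hQ1 : 1 ≤ countRows D.M (X - 1) := by
    have := Finset.single_le_sum
      (f := fun r : Fin s => if X - 1 < ∑ c, D.M r c then (1 : ℤ) else 0)
      (fun r _ => by split_ifs <;> simp) (Finset.mem_univ i)
    rwa [if_pos (by omega)] at this
  let a : Fin s := ⟨(countRows D.M X).toNat, by omega⟩
  let b : Fin s := ⟨(countRows D.M (X - 1) - 1).toNat, by omega⟩
  have ha : ((a : ℕ) : ℤ) = countRows D.M X := Int.toNat_of_nonneg (by omega)
  have hb : ((b : ℕ) : ℤ) = countRows D.M (X - 1) - 1 := Int.toNat_of_nonneg (by omega)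
  -- The common part of the two diagrams: the row diagram without the last cell of column `X - 1`.
  -- Adding the first free cell of column `X` instead gives the column diagram.
  let K : Fin s → Fin t → ℤ := fun r c =>
    (if (r : ℤ) < countRows D.M c then 1 else 0) - if r = b ∧ c = q then 1 else 0
  have e1 := D.grid.fn_add_single K b q
  have e2 := D.grid.fn_add_single K a p
  have k1 : (fun r c => K r c + if r = b ∧ c = q then 1 else 0) =
      fun (r : Fin s) (c : Fin t) => if (r : ℤ) < countRows D.M c then (1 : ℤ) else 0 := by
    funext r c
    simp only [K]
    ring
  have k2 : (fun r c => K r c + if r = a ∧ c = p then 1 else 0) =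
      fun (r : Fin s) (c : Fin t) => if (c : ℤ) < countCols D.M r then (1 : ℤ) else 0 := by
    funext r c
    have h1 := h.lt_countCols_iff D.isZeroOne (a := r) (b := c) (by omega) (by omega)
    rw [← hX] at h1
    simp only [K, h1]
    have hr : ∀ r' : Fin s, r = r' ↔ (r : ℤ) = r' := fun r' => by rw [Fin.ext_iff]; omega
    have hc : ∀ c' : Fin t, c = c' ↔ (c : ℤ) = c' := fun c' => by rw [Fin.ext_iff]; omega
    simp only [hr, hc, ha, hb, hp, hq]
    by_cases c1 : (c : ℤ) = X
    · rw [c1]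
      have : ¬ X = X - 1 := by omega
      simp only [this, and_false, and_true, if_true, if_false]
      split_ifs <;> omega
    · by_cases c2 : (c : ℤ) = X - 1
      · rw [c2]
        have : ¬ X - 1 = X := by omega
        simp only [this, and_false, and_true, if_true, if_false]
        split_ifs <;> omega
      · simp only [c1, c2, and_false, if_false]
        simp
  rw [k1, ← D.maya_corePart_sig] at e1
  rw [k2, ← D.maya_corePart_tau] at e2
  refine ⟨D.grid.pos b q (K b q), D.grid.pos a p (K a p), ?_, ?_⟩
  · intro hcon
    exact hpq (D.grid.pos_inj.mp hcon).2.1.symm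
  · rw [e2, moveBead, e1, add_sub_cancel_right]

/-- If the matrix has only one interchange, the two cores of cores differ by a rim hook. -/
theorem exists_isRimHookRemoval {i k : Fin s} {j l : Fin t} (h : OnlyInterchange D.M i k j l) :
    ∃ n, IsRimHookRemoval n (corePart t sig) (corePart s tau) ∨
      IsRimHookRemoval n (corePart s tau) (corePart t sig) := by
  obtain ⟨x, y, hxy, hm⟩ := D.exists_moveBead h
  rcases hxy.lt_or_gt with hlt | hlt
  · refine ⟨(y - x).toNat, Or.inr (isRimHookRemoval_of_moveBead (by omega) (x := y) ?_)⟩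
    rw [Int.toNat_of_nonneg (by omega), sub_sub_cancel, hm, moveBead, moveBead]
    abel
  · refine ⟨(x - y).toNat, Or.inl (isRimHookRemoval_of_moveBead (by omega) (x := x) ?_)⟩
    rw [Int.toNat_of_nonneg (by omega), sub_sub_cancel, hm]

/-- A single bead move changes the column moment by a difference of two column indices below `t`. -/
theorem marginGap_le_of_isRimHookRemoval (h : ∃ n,
    IsRimHookRemoval n (corePart t sig) (corePart s tau) ∨
      IsRimHookRemoval n (corePart s tau) (corePart t sig)) :
    marginGap D.M ≤ 2 * (t - 1) := by
  rw [D.marginGap_eq_pairing_col]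
  obtain ⟨n, h | h⟩ := h
  all_goals
    obtain ⟨x, hx⟩ := h.exists_maya_eq
    rw [hx, pairing_moveBead]
    have h1 := (D.grid.col x).2
    have h2 := (D.grid.col (x - n)).2
    omega

/-- The size of the minimal partitions, the sizes and the weights of the cores. -/
theorem size_eq : 2 * (D.size - (sig.card + s * coreWeight s tau)) = s * marginGap D.M := by
  have h := D.two_mul_pairing_id_fn_M
  have h1 : (tau.card : ℤ) = (corePart s tau).card + s * coreWeight s tau := by
    exact_mod_cast (corePart_spec s tau).2.2
  rw [size, ← h, h1]
  ring

theorem size_swap : D.swap.size = D.size := by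
  rw [size, size, ← D.swap_fn]
  rfl

theorem eq_size_iff_marginGap (n : ℤ) (hn : n = D.size) :
    n = sig.card + s * (coreWeight s tau + 1) ↔ marginGap D.M = 2 := by
  have h := D.size_eq
  have hs : (s : ℤ) ≠ 0 := by exact_mod_cast D.grid.s_pos.ne'
  subst hn
  constructor
  · intro h1
    refine mul_left_cancel₀ hs ?_
    linarith
  · intro h1
    rw [h1] at h
    linarith

/-- The two partitions related by an interchange are not both self-conjugate. -/
theorem not_both_transpose_eq {i k : Fin s} {j l : Fin t} (hI : Interchange D.M i k j l)
    {lam mu : YoungDiagram} (hlam : lam.maya = D.fn D.M)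
    (hmu : mu.maya = D.fn (rectChange D.M i k j l)) :
    ¬ (lam.transpose = lam ∧ mu.transpose = mu) := by
  rintro ⟨h1, h2⟩
  have hrefl : ∀ x, lam.maya (-1 - x) - mu.maya (-1 - x) = -(lam.maya x - mu.maya x) := by
    intro x
    have e1 := lam.maya_transpose x
    have e2 := mu.maya_transpose x
    rw [h1] at e1
    rw [h2] at e2
    linarith
  have hik := hI.ne_row
  have hjl := hI.ne_col
  have hpos : ∀ a b, rectChange D.M i k j l a b = D.M a b - 1 →
      lam.maya (D.base a b) - mu.maya (D.base a b) = 1 := by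
    intro a b hab
    have e1 := D.occ_fn_base_add D.M a b 0
    have e2 := D.occ_fn_base_add (rectChange D.M i k j l) a b 0
    rw [mul_zero, add_zero] at e1 e2
    rw [← occ_sub_occ, hlam, hmu, e1, e2, hab]
    have h3 := D.isZeroOne a b
    have h4 := hI.isZeroOne_rectChange D.isZeroOne a b
    rw [if_pos (by omega), if_neg (by omega)]
    rfl
  have hneg : ∀ x, lam.maya x - mu.maya x = -1 → x = D.base i l ∨ x = D.base k j := by
    intro x hx
    obtain ⟨a, b, hx', -, -⟩ := D.exists_base_add x
    have e1 := D.occ_fn_base_add D.M a b (D.level x)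
    have e2 := D.occ_fn_base_add (rectChange D.M i k j l) a b (D.level x)
    rw [← hx'] at e1 e2
    rw [← occ_sub_occ, hlam, hmu, e1, e2] at hx
    have h3 := D.isZeroOne a b
    have h4 := hI.isZeroOne_rectChange D.isZeroOne a b
    have h5 : D.level x = 0 ∧ rectChange D.M i k j l a b = D.M a b + 1 := by
      split_ifs at hx <;> omega
    rw [h5.1, mul_zero, add_zero] at hx'
    have h6 := h5.2
    rw [rectChange] at h6
    rw [hx']
    by_cases c1 : a = k <;> by_cases c2 : a = i <;> by_cases c3 : b = j <;> by_cases c4 : b = l <;>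
      simp_all
  -- Self-conjugacy of both would let the reflection send the two beads `(i, j)`, `(k, l)` lost by
  -- the interchange into the two gained ones `(i, l)`, `(k, j)`. As the two pairs of positions have
  -- equal sums, every assignment forces a coincidence.
  have g1 := hneg (-1 - D.base i j) (by
    rw [hrefl, hpos i j (by simp [rectChange, hik, hjl]; ring)])
  have g2 := hneg (-1 - D.base k l) (by
    rw [hrefl, hpos k l (by simp [rectChange, hik.symm, hjl.symm]; ring)])
  have e := D.base_add_base i k j l
  have n1 : D.base i j ≠ D.base k l := fun h => hik (D.base_inj h).1
  have n2 : D.base i j ≠ D.base k j := fun h => hik (D.base_inj h).1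
  have n3 : D.base i j ≠ D.base i l := fun h => hjl (D.base_inj h).2
  omega

end CoreWindow

theorem theorem5p13 (s t : ℕ) (hs : 1 < s) (ht : 1 < t) (hst : Nat.Coprime s t)
    (sig tau : YoungDiagram) (hsig : IsCorePartition s sig) (htau : IsCorePartition t tau)
    (n : ℕ) :
    List.TFAE [
      (partitionsWithCores s t sig tau n).ncard = 2 ∧
        ∃ lam : YoungDiagram, partitionsWithCores s t sig tau n = {lam, lam.transpose},
      sig.transpose = sig ∧ tau.transpose = tau ∧
        (∃ k : ℕ, IsRimHookRemoval k (corePart t sig) (corePart s tau) ∨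
          IsRimHookRemoval k (corePart s tau) (corePart t sig)) ∧
        n = sig.card + s * (coreWeight s tau + 1) ∧
        n = tau.card + t * (coreWeight t sig + 1),
      sig.transpose = sig ∧ tau.transpose = tau ∧
        n = minSizeWithCores s t sig tau ∧
        n = sig.card + s * (coreWeight s tau + 1) ∧
        n = tau.card + t * (coreWeight t sig + 1)] := by
  obtain ⟨D⟩ := nonempty_coreWindow (by omega) (by omega) hst hsig htau
  have hs0 : (0 : ℤ) < s := by omega
  have ht0 : (0 : ℤ) < t := by omega
  have hw1 : (n = sig.card + s * (coreWeight s tau + 1)) ↔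
      (n : ℤ) = sig.card + s * (coreWeight s tau + 1) := by
    norm_cast
  have hw2 : (n = tau.card + t * (coreWeight t sig + 1)) ↔
      (n : ℤ) = tau.card + t * (coreWeight t sig + 1) := by
    norm_cast
  have hmin : n = minSizeWithCores s t sig tau ↔ (n : ℤ) = D.size := by
    rw [← D.minSizeWithCores_eq]
    norm_cast
  rw [hw1, hw2, hmin]
  tfae_have 1 → 2 := by
    rintro ⟨hcard, lam, hlam⟩
    have hmem : lam ∈ partitionsWithCores s t sig tau n := by rw [hlam]; simp
    have hmem' : lam.transpose ∈ partitionsWithCores s t sig tau n := by rw [hlam]; simp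
    have hne : lam ≠ lam.transpose := by
      intro h
      rw [hlam, ← h, Set.pair_eq_singleton, Set.ncard_singleton] at hcard
      omega
    have hn : (n : ℤ) = D.size := by
      by_contra hcon
      obtain ⟨F, hF, hFm⟩ := D.exists_injective_of_size_lt hmem hcon
      -- Since `s` and `t` exceed 1, the grid has at least three places, already more than the two
      -- partitions available.
      let p : Fin s × Fin t := (⟨0, by omega⟩, ⟨0, by omega⟩)
      let q : Fin s × Fin t := (⟨1, hs⟩, ⟨0, by omega⟩)
      let r : Fin s × Fin t := (⟨0, by omega⟩, ⟨1, ht⟩)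
      have hpq : F p ≠ F q := hF.ne (by simp [p, q])
      have hpr : F p ≠ F r := hF.ne (by simp [p, r])
      have hqr : F q ≠ F r := hF.ne (by simp [q, r])
      have h1 := hFm p
      have h2 := hFm q
      have h3 := hFm r
      rw [hlam, Set.mem_insert_iff, Set.mem_singleton_iff] at h1 h2 h3
      rcases h1 with h1 | h1 <;> rcases h2 with h2 | h2 <;> rcases h3 with h3 | h3 <;>
        simp_all
    obtain ⟨N, hN, hMN, hNlam⟩ := D.exists_matrix hn hmem
    obtain ⟨N', hN', hMN', hNlam'⟩ := D.exists_matrix hn hmem'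
    have hNN' : N ≠ N' := by
      rintro rfl
      exact hne (YoungDiagram.maya_injective (hNlam.trans hNlam'.symm))
    have hall : ∀ K, IsZeroOne K → SameMargins D.M K → K = N ∨ K = N' := by
      intro K hK hMK
      obtain ⟨mu, hmu, hmuK⟩ := D.exists_mem_of_matrix hn hK hMK
      rw [hlam, Set.mem_insert_iff, Set.mem_singleton_iff] at hmu
      rcases hmu with rfl | rfl
      · exact Or.inl (D.fn_injective (hmuK.symm.trans hNlam))
      · exact Or.inr (D.fn_injective (hmuK.symm.trans hNlam'))
    have honly : ∃ i k j l, OnlyInterchange D.M i k j l := by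
      rcases hall D.M D.isZeroOne ⟨fun _ => rfl, fun _ => rfl⟩ with h | h
      · rw [← h] at hall hNN'
        exact exists_onlyInterchange_of_two D.isZeroOne hN' hMN' hNN' hall
      · rw [← h] at hall hNN'
        exact exists_onlyInterchange_of_two D.isZeroOne hN hMN hNN'.symm
          fun K hK hMK => (hall K hK hMK).symm
    obtain ⟨i, k, j, l, hI⟩ := honly
    refine ⟨?_, ?_, D.exists_isRimHookRemoval hI, ?_, ?_⟩
    · have h1 := hmem.2.1
      have h2 := hmem'.2.1
      rw [corePart_transpose (by omega), h1] at h2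
      exact h2
    · have h1 := hmem.2.2
      have h2 := hmem'.2.2
      rw [corePart_transpose (by omega), h1] at h2
      exact h2
    · exact (D.eq_size_iff_marginGap n hn).mpr (marginGap_of_onlyInterchange D.isZeroOne hI)
    · exact (D.swap.eq_size_iff_marginGap n (hn.trans D.size_swap.symm)).mpr
        (marginGap_of_onlyInterchange D.swap.isZeroOne hI.swap)
  tfae_have 2 → 3 := by
    rintro ⟨h1, h2, hrim, h3, h4⟩
    refine ⟨h1, h2, ?_, h3, h4⟩
    have g1 := D.size_eq
    have g2 := D.swap.size_eq
    rw [D.size_swap] at g2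
    obtain ⟨a, ha⟩ : ∃ a, marginGap D.M = 2 * a := ⟨_, D.marginGap_eq_pairing_col⟩
    obtain ⟨b, hb⟩ : ∃ b, marginGap D.swap.M = 2 * b := ⟨_, D.swap.marginGap_eq_pairing_col⟩
    have hle := D.marginGap_le_of_isRimHookRemoval hrim
    have hge := marginGap_nonneg D.isZeroOne
    rw [ha] at g1 hle hge
    rw [hb] at g2
    -- Both equations express the same difference, as `D.size - n = s * (a - 1) = t * (b - 1)`. The
    -- rim hook gives `0 ≤ a ≤ t - 1`, so `a - 1` is a multiple of `t` of smaller absolute value.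
    have hdvd : (t : ℤ) ∣ s * (a - 1) := ⟨b - 1, by linarith⟩
    have hdvd' : (t : ℤ) ∣ a - 1 :=
      IsCoprime.dvd_of_dvd_mul_left (Nat.isCoprime_iff_coprime.mpr hst.symm) hdvd
    have ha1 : a - 1 = 0 := Int.eq_zero_of_abs_lt_dvd hdvd' (by rw [abs_lt]; omega)
    have : a = 1 := by omega
    subst this
    linarith
  tfae_have 3 → 1 := by
    rintro ⟨h1, h2, hn, h3, h4⟩
    have g1 := (D.eq_size_iff_marginGap n hn).mp h3
    have g2 := (D.swap.eq_size_iff_marginGap n (hn.trans D.size_swap.symm)).mp h4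
    obtain ⟨i, k, j, l, hI⟩ := exists_onlyInterchange_of_marginGap D.isZeroOne g1 g2
    obtain ⟨lam, hlam, hlamM⟩ := D.exists_mem_of_matrix hn D.isZeroOne ⟨fun _ => rfl, fun _ => rfl⟩
    obtain ⟨mu, hmu, hmuM⟩ := D.exists_mem_of_matrix hn (hI.1.isZeroOne_rectChange D.isZeroOne)
      (sameMargins_rectChange D.M i k j l)
    have hne : lam ≠ mu := by
      rintro rfl
      have h5 := congrFun (congrFun (D.fn_injective (hlamM.symm.trans hmuM)) i) j
      rw [hI.1.rectChange_apply, hI.1.1] at h5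
      omega
    have hall : ∀ nu ∈ partitionsWithCores s t sig tau n, nu = lam ∨ nu = mu := by
      intro nu hnu
      obtain ⟨N, hN, hMN, hnuN⟩ := D.exists_matrix hn hnu
      rcases hI.eq_or_eq D.isZeroOne hN hMN with rfl | rfl
      · exact Or.inl (YoungDiagram.maya_injective (hnuN.trans hlamM.symm))
      · exact Or.inr (YoungDiagram.maya_injective (hnuN.trans hmuM.symm))
    have hset : partitionsWithCores s t sig tau n = {lam, mu} := by
      ext nu
      rw [Set.mem_insert_iff, Set.mem_singleton_iff]
      refine ⟨hall nu, ?_⟩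
      rintro (rfl | rfl)
      · exact hlam
      · exact hmu
    -- Conjugation is an involution on the two partitions; if it fixed one it would fix the other as
    -- well.
    have htr : lam.transpose = mu := by
      refine (hall _ (transpose_mem_partitionsWithCores hs.le ht.le h1 h2 hlam)).resolve_left fun hcon => ?_
      refine D.not_both_transpose_eq hI.1 hlamM hmuM ⟨hcon, ?_⟩
      refine (hall _ (transpose_mem_partitionsWithCores hs.le ht.le h1 h2 hmu)).resolve_left fun hcon' => hne ?_
      rw [← hcon', YoungDiagram.transpose_transpose] at hcon
      exact hcon'.symm.trans hcon.symm
    refine ⟨?_, lam, ?_⟩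
    · rw [hset, Set.ncard_pair hne]
    · rw [hset, htr]
  tfae_finish
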